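/- Let $k=\mathbb R$ or $k=\mathbb C$, let $q\in k$ be nonzero and not a root of unity, and let $c\in k$, $c\neq 0$. Let $U_q(sl(2))$ be the algebra generated by $X,Y,K^{\pm1}$ (with $K=q^H$) subject to $KX=q^2XK$, $KY=q^{-2}YK$, $XY-YX=\frac{K-K^{-1}}{q-q^{-1}}$, with coproduct $\Delta(X)=X\otimes 1+K^{-1}\otimes X$, $\Delta(Y)=Y\otimes K+1\otimes Y$, $\Delta(K)=K\otimes K$ and counit $\varepsilon(X)=\varepsilon(Y)=0$, $\varepsilon(K)=1$. Let $V$ be the $U_q(sl(2))$-module with basis $(u,v,w)$ and $$X.u=0,\ X.v=-(q+q^{-1})u,\ X.w=v,\quad Y.u=-v,\ Y.v=(q+q^{-1})w,\ Y.w=0,\quad H.u=2u,\ H.v=0,\ H.w=-2w.$$ Put $$v_0=(q^3+q)\,u\otimes w+v\otimes v+(q+q^{-1})\,w\otimes u\in V^{\otimes 2},$$ $$V_1=\mathrm{span}\bigl(q^2u\otimes v-v\otimes u,\ (q^3+q)(u\otimes w-w\otimes u)+(1-q^2)v\otimes v,\ w\otimes v-q^2v\otimes w\bigr)\subset V^{\otimes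 2},$$ and let $A=k(S^2_q)=T(V)/\{V_1,\,v_0-c\}$ be the quantum sphere, the quotient of the tensor algebra by the two-sided ideal generated by $V_1$ and $v_0-c$, with product $\mu:A\otimes A\to A$ and with the action of $U_q(sl(2))$ that extends the one on $V$ through the coproduct: $h.(ab)=\sum(h_{(1)}.a)(h_{(2)}.b)$, $h.1=\varepsilon(h)1$. Let $$\mathcal R=\Bigl(\sum_{n\ge 0}q^{n(n-1)/2}\,\frac{(q-q^{-1})^n}{[n]!}\,X^n\otimes Y^n\Bigr)q^{H\otimes H/2},\qquad [n]!=\prod_{i=1}^n\frac{q^i-q^{-i}}{q-q^{-1}},$$ be the universal $R$-matrix. It acts on $A\otimes A$: $X$ is locally nilpotent on $A$, and $q^{H\otimes H/2}$ is the scalar $q^{\lambda\lambda'/2}$ on the tensor product of the subspaces of $A$ of weights $\lambda,\lambda'\in 2\mathbb Z$, that is, of eigenvalues $\lambda,\lambda'$ of $H$, where $H$ acts on $A$ as the derivation extending its action on $V$. Let $\sigma$ be the flip of $A\otimes A$ and $S=\sigma\mathcal R:A\otimes A\to A\otimes A$. For an operator on two factors, the superscripts $12$, $23$ denote it applied to the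 first and second, respectively second and third, factors of $A\otimes A\otimes A$. Then $S$ is invertible, and, as maps $A\otimes A\otimes A\to A\otimes A$, $$S\mu^{12}=\mu^{23}S^{12}S^{23},\qquad S\mu^{23}=\mu^{12}S^{23}S^{12},$$ $$S^{-1}\mu^{12}=\mu^{23}(S^{-1})^{12}(S^{-1})^{23},\qquad S^{-1}\mu^{23}=\mu^{12}(S^{-1})^{23}(S^{-1})^{12}.$$ -/

import Mathlib

open scoped TensorProduct

noncomputable section

set_option linter.unusedSimpArgs false
set_option linter.unnecessarySeqFocus false

namespace QSphere

variable {k : Type*} [Field k]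

/-- The generators of `U_q(sl(2))`; `K` stands for `q ^ H`. -/
inductive UGen
  | X | Y | K | Kinv

open FreeAlgebra in
/-- The defining relations of `U_q(sl(2))`. -/
inductive URel (q : kˣ) : FreeAlgebra k UGen → FreeAlgebra k UGen → Prop
  | K_Kinv : URel q (ι k UGen.K * ι k UGen.Kinv) 1
  | Kinv_K : URel q (ι k UGen.Kinv * ι k UGen.K) 1
  | K_X : URel q (ι k UGen.K * ι k UGen.X) ((q : k) ^ 2 • (ι k UGen.X * ι k UGen.K))
  | K_Y : URel q (ι k UGen.K * ι k UGen.Y) (((q : k) ^ 2)⁻¹ • (ι k UGen.Y * ι k UGen.K))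
  | X_Y : URel q
      (((q : k) - (q : k)⁻¹) • (ι k UGen.X * ι k UGen.Y - ι k UGen.Y * ι k UGen.X))
      (ι k UGen.K - ι k UGen.Kinv)

/-- The quantum group `U_q(sl(2))`, as an algebra. -/
def Uq (q : kˣ) : Type _ := RingQuot (URel q)

instance (q : kˣ) : Ring (Uq q) := inferInstanceAs (Ring (RingQuot (URel q)))

instance (q : kˣ) : Algebra k (Uq q) := inferInstanceAs (Algebra k (RingQuot (URel q)))

namespace Uq

variable (q : kˣ)

/-- The image of a generator in `U_q(sl(2))`. -/
def gen (g : UGen) : Uq q := RingQuot.mkAlgHom k (URel q) (FreeAlgebra.ι k g)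

/-- An algebra map out of `U_q(sl(2))`, from images of the generators obeying the relations. -/
def lift {B : Type*} [Ring B] [Algebra k B] (f : UGen → B)
    (h₁ : f .K * f .Kinv = 1) (h₂ : f .Kinv * f .K = 1)
    (h₃ : f .K * f .X = (q : k) ^ 2 • (f .X * f .K))
    (h₄ : f .K * f .Y = ((q : k) ^ 2)⁻¹ • (f .Y * f .K))
    (h₅ : ((q : k) - (q : k)⁻¹) • (f .X * f .Y - f .Y * f .X) = f .K - f .Kinv) :
    Uq q →ₐ[k] B :=
  RingQuot.liftAlgHom k ⟨FreeAlgebra.lift k f, by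
    intro x y h
    cases h <;> simpa⟩

variable {q}

@[simp] theorem lift_gen {B : Type*} [Ring B] [Algebra k B] (f : UGen → B) (h₁ h₂ h₃ h₄ h₅)
    (g : UGen) : lift q f h₁ h₂ h₃ h₄ h₅ (gen q g) = f g := by
  unfold lift gen
  erw [RingQuot.liftAlgHom_mkAlgHom_apply]
  simp

theorem algHom_ext {B : Type*} [Semiring B] [Algebra k B] {f g : Uq q →ₐ[k] B}
    (h : ∀ x, f (gen q x) = g (gen q x)) : f = g := by
  refine RingQuot.ringQuot_ext' k f g ?_
  ext x
  exact h x

theorem K_Kinv : gen q .K * gen q .Kinv = 1 := by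
  have := RingQuot.mkAlgHom_rel k (URel.K_Kinv (q := q))
  rw [map_mul, map_one] at this
  exact this

theorem Kinv_K : gen q .Kinv * gen q .K = 1 := by
  have := RingQuot.mkAlgHom_rel k (URel.Kinv_K (q := q))
  rw [map_mul, map_one] at this
  exact this

theorem K_X : gen q .K * gen q .X = (q : k) ^ 2 • (gen q .X * gen q .K) := by
  have := RingQuot.mkAlgHom_rel k (URel.K_X (q := q))
  rw [map_smul, map_mul, map_mul] at this
  exact this

theorem K_Y : gen q .K * gen q .Y = ((q : k) ^ 2)⁻¹ • (gen q .Y * gen q .K) := by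
  have := RingQuot.mkAlgHom_rel k (URel.K_Y (q := q))
  rw [map_smul, map_mul, map_mul] at this
  exact this

theorem X_Y : ((q : k) - (q : k)⁻¹) • (gen q .X * gen q .Y - gen q .Y * gen q .X) =
    gen q .K - gen q .Kinv := by
  have := RingQuot.mkAlgHom_rel k (URel.X_Y (q := q))
  rw [map_smul, map_sub, map_sub, map_mul, map_mul] at this
  exact this

theorem X_Kinv : gen q .X * gen q .Kinv = (q : k) ^ 2 • (gen q .Kinv * gen q .X) := by
  have h : gen q .Kinv * (gen q .K * gen q .X) * gen q .Kinv = gen q .X * gen q .Kinv := by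
    rw [← mul_assoc, Kinv_K, one_mul]
  rw [← h, K_X, mul_smul_comm, smul_mul_assoc, mul_assoc, mul_assoc, K_Kinv, mul_one]

theorem Y_Kinv : gen q .Y * gen q .Kinv = ((q : k) ^ 2)⁻¹ • (gen q .Kinv * gen q .Y) := by
  have h : gen q .Kinv * (gen q .K * gen q .Y) * gen q .Kinv = gen q .Y * gen q .Kinv := by
    rw [← mul_assoc, Kinv_K, one_mul]
  rw [← h, K_Y, mul_smul_comm, smul_mul_assoc, mul_assoc, mul_assoc, K_Kinv, mul_one]

/-- The coproduct on generators. -/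
def comulGen (q : kˣ) : UGen → Uq q ⊗[k] Uq q
  | .X => gen q .X ⊗ₜ 1 + gen q .Kinv ⊗ₜ gen q .X
  | .Y => gen q .Y ⊗ₜ gen q .K + 1 ⊗ₜ gen q .Y
  | .K => gen q .K ⊗ₜ gen q .K
  | .Kinv => gen q .Kinv ⊗ₜ gen q .Kinv

/-- The coproduct `Δ(X) = X ⊗ 1 + K⁻¹ ⊗ X`, `Δ(Y) = Y ⊗ K + 1 ⊗ Y`, `Δ(K) = K ⊗ K`. -/
def comulHom (q : kˣ) : Uq q →ₐ[k] Uq q ⊗[k] Uq q :=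
  lift q (comulGen q)
    (by simp [comulGen, K_Kinv, Algebra.TensorProduct.one_def])
    (by simp [comulGen, Kinv_K, Algebra.TensorProduct.one_def])
    (by
      simp only [comulGen, mul_add, add_mul, Algebra.TensorProduct.tmul_mul_tmul, K_X, K_Kinv,
        Kinv_K, mul_one, one_mul, smul_add, TensorProduct.smul_tmul', TensorProduct.tmul_smul])
    (by
      simp only [comulGen, mul_add, add_mul, Algebra.TensorProduct.tmul_mul_tmul, K_Y,
        mul_one, one_mul, smul_add, TensorProduct.smul_tmul', TensorProduct.tmul_smul])
    (by
      have hq : (q : k) ^ 2 ≠ 0 := pow_ne_zero 2 q.ne_zero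
      have e1 : (gen q .Y * gen q .Kinv) ⊗ₜ[k] (gen q .K * gen q .X)
          = (gen q .Kinv * gen q .Y) ⊗ₜ[k] (gen q .X * gen q .K) := by
        rw [Y_Kinv, K_X, TensorProduct.tmul_smul, TensorProduct.smul_tmul', smul_smul,
          mul_inv_cancel₀ hq, one_smul]
      have e2 : comulGen q .X * comulGen q .Y - comulGen q .Y * comulGen q .X =
          (gen q .X * gen q .Y - gen q .Y * gen q .X) ⊗ₜ[k] gen q .K +
            gen q .Kinv ⊗ₜ[k] (gen q .X * gen q .Y - gen q .Y * gen q .X) := by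
        simp only [comulGen, mul_add, add_mul, Algebra.TensorProduct.tmul_mul_tmul, mul_one,
          one_mul, e1, TensorProduct.sub_tmul, TensorProduct.tmul_sub]
        abel
      rw [e2, smul_add, TensorProduct.smul_tmul', ← TensorProduct.tmul_smul, X_Y,
        TensorProduct.sub_tmul, TensorProduct.tmul_sub]
      simp only [comulGen]
      abel)

/-- The counit. -/
def counitHom (q : kˣ) : Uq q →ₐ[k] k :=
  lift q (fun | .X => 0 | .Y => 0 | .K => 1 | .Kinv => 1)
    (by simp) (by simp) (by simp) (by simp) (by simp)

instance (q : kˣ) : Bialgebra k (Uq q) :=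
  Bialgebra.ofAlgHom (comulHom q) (counitHom q)
    (by
      refine algHom_ext fun x => ?_
      cases x <;> simp [comulHom, comulGen, TensorProduct.tmul_add, TensorProduct.add_tmul, Algebra.TensorProduct.one_def, add_assoc])
    (by
      refine algHom_ext fun x => ?_
      cases x <;> simp [comulHom, comulGen, counitHom])
    (by
      refine algHom_ext fun x => ?_
      cases x <;> simp [comulHom, comulGen, counitHom])


theorem comul_gen (x : UGen) : Coalgebra.comul (R := k) (gen q x) = comulGen q x :=
  lift_gen _ _ _ _ _ _ x

end Uq

/-- The three-dimensional space with basis `(u, v, w)`. -/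
abbrev V (k : Type*) := Fin 3 → k

/-- The first basis vector of `V`, of weight `2`. -/
def u : V k := ![1, 0, 0]

/-- The second basis vector of `V`, of weight `0`. -/
def v : V k := ![0, 1, 0]

/-- The third basis vector of `V`, of weight `-2`. -/
def w : V k := ![0, 0, 1]

/-- The matrices of the generators in the basis `(u, v, w)`:
`X.u = 0`, `X.v = -(q + q⁻¹) u`, `X.w = v`, `Y.u = -v`, `Y.v = (q + q⁻¹) w`, `Y.w = 0`, and
`H.u = 2 u`, `H.v = 0`, `H.w = -2 w` with `K = q ^ H`. -/
def matV (q : kˣ) : UGen → Matrix (Fin 3) (Fin 3) k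
  | .X => !![0, -((q : k) + (q : k)⁻¹), 0; 0, 0, 1; 0, 0, 0]
  | .Y => !![0, 0, 0; -1, 0, 0; 0, (q : k) + (q : k)⁻¹, 0]
  | .K => !![(q : k) ^ 2, 0, 0; 0, 1, 0; 0, 0, ((q : k) ^ 2)⁻¹]
  | .Kinv => !![((q : k) ^ 2)⁻¹, 0, 0; 0, 1, 0; 0, 0, (q : k) ^ 2]

/-- The `U_q(sl(2))`-module structure of `V`. -/
def rhoV (q : kˣ) : Uq q →ₐ[k] Module.End k (V k) :=
  (Matrix.toLinAlgEquiv' (R := k) (n := Fin 3)).toAlgHom.comp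
    (Uq.lift q (matV q)
      (by ext i j; fin_cases i <;> fin_cases j <;> simp [matV, Matrix.mul_apply, Fin.sum_univ_three])
      (by ext i j; fin_cases i <;> fin_cases j <;> simp [matV, Matrix.mul_apply, Fin.sum_univ_three])
      (by ext i j; fin_cases i <;> fin_cases j <;> simp [matV, Matrix.mul_apply, Fin.sum_univ_three])
      (by ext i j; fin_cases i <;> fin_cases j <;> simp [matV, Matrix.mul_apply, Fin.sum_univ_three])
      (by ext i j; fin_cases i <;> fin_cases j <;>
            simp [matV, Matrix.mul_apply, Fin.sum_univ_three] <;> field_simp <;> ring))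

/-- The `U_q(sl(2))`-module structure of `V ⊗ V`, through the coproduct. -/
def rhoVV (q : kˣ) : Uq q →ₐ[k] Module.End k (V k ⊗[k] V k) :=
  (Module.endTensorEndAlgHom (R := k) (S := k) (A := k) (M := V k) (N := V k)).comp
    ((Algebra.TensorProduct.map (rhoV q) (rhoV q)).comp (Uq.comulHom q))

/-- The generator `v₀` of the trivial component `V₀` of `V ⊗ V`. -/
def v0 (q : kˣ) : V k ⊗[k] V k :=
  ((q : k) ^ 3 + q) • (u ⊗ₜ w) + v ⊗ₜ v + ((q : k) + (q : k)⁻¹) • (w ⊗ₜ u)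

/-- The spin one component `V₁` of `V ⊗ V`. -/
def V1 (q : kˣ) : Submodule k (V k ⊗[k] V k) :=
  Submodule.span k
    {(q : k) ^ 2 • (u ⊗ₜ v) - v ⊗ₜ u,
     ((q : k) ^ 3 + q) • (u ⊗ₜ w - w ⊗ₜ u) + (1 - (q : k) ^ 2) • (v ⊗ₜ v),
     w ⊗ₜ v - (q : k) ^ 2 • (v ⊗ₜ w)}

/-- The inclusion of `V ⊗ V` into the tensor algebra, in degree two. -/
def incl2 (k : Type*) [Field k] : V k ⊗[k] V k →ₗ[k] TensorAlgebra k (V k) :=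
  LinearMap.mul' k _ ∘ₗ TensorProduct.map (TensorAlgebra.ι k) (TensorAlgebra.ι k)

/-- The defining relations `V₁ = 0`, `v₀ = c` of the quantum sphere. -/
inductive SphereRel (q : kˣ) (c : k) : TensorAlgebra k (V k) → TensorAlgebra k (V k) → Prop
  | spin1 (x : V k ⊗[k] V k) (hx : x ∈ V1 q) : SphereRel q c (incl2 k x) 0
  | spin0 : SphereRel q c (incl2 k (v0 q)) (algebraMap k _ c)

/-- The quantum sphere `k(S²_q) = T(V) / {V₁, v₀ - c}`. -/
def Sphere (q : kˣ) (c : k) : Type _ := RingQuot (SphereRel q c)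

instance (q : kˣ) (c : k) : Ring (Sphere q c) :=
  inferInstanceAs (Ring (RingQuot (SphereRel q c)))

instance (q : kˣ) (c : k) : Algebra k (Sphere q c) :=
  inferInstanceAs (Algebra k (RingQuot (SphereRel q c)))

namespace Sphere

/-- The quotient map from the tensor algebra of `V` to the quantum sphere. -/
def mk (q : kˣ) (c : k) : TensorAlgebra k (V k) →ₐ[k] Sphere q c :=
  RingQuot.mkAlgHom k (SphereRel q c)

/-- The canonical map from `V` to the quantum sphere. -/
def ι (q : kˣ) (c : k) : V k →ₗ[k] Sphere q c :=
  (mk q c).toLinearMap ∘ₗ TensorAlgebra.ι k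

/-- The linear map `x ⊗ y ↦ f x * f y` on `V ⊗ V`. -/
def mul2 {B : Type*} [Ring B] [Algebra k B] (f : V k →ₗ[k] B) : V k ⊗[k] V k →ₗ[k] B :=
  LinearMap.mul' k B ∘ₗ TensorProduct.map f f

/-- An algebra map out of the quantum sphere. -/
def lift (q : kˣ) (c : k) {B : Type*} [Ring B] [Algebra k B] (f : V k →ₗ[k] B)
    (h₁ : ∀ x ∈ V1 q, mul2 f x = 0) (h₀ : mul2 f (v0 q) = algebraMap k B c) :
    Sphere q c →ₐ[k] B :=
  RingQuot.liftAlgHom k ⟨TensorAlgebra.lift k f, by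
    have h (x) : TensorAlgebra.lift k f (incl2 k x) = mul2 f x := by
      induction x with
      | zero => simp
      | tmul x y => simp [incl2, mul2]
      | add x y hx hy => simp [hx, hy]
    intro x y hxy
    cases hxy with
    | spin1 x hx => rw [h, map_zero, h₁ x hx]
    | spin0 => rw [h, h₀, AlgHom.commutes]⟩

variable {q : kˣ} {c : k}

@[simp] theorem lift_ι {B : Type*} [Ring B] [Algebra k B] (f : V k →ₗ[k] B) (h₁ h₀) (x : V k) :
    lift q c f h₁ h₀ (ι q c x) = f x := by
  unfold lift ι mk
  erw [RingQuot.liftAlgHom_mkAlgHom_apply]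
  simp

theorem mul2_ι (x) : mul2 (ι q c) x = mk q c (incl2 k x) := by
  induction x with
  | zero => simp only [map_zero]
  | tmul x y => simp [incl2, mul2, ι]
  | add x y hx hy => simp only [map_add, hx, hy]

theorem mul2_V1 {x} (hx : x ∈ V1 q) : mul2 (ι q c) x = 0 := by
  rw [mul2_ι, ← map_zero (mk q c)]
  exact RingQuot.mkAlgHom_rel k (SphereRel.spin1 x hx)

theorem mul2_v0 : mul2 (ι q c) (v0 q) = algebraMap k _ c := by
  rw [mul2_ι, ← (mk q c).commutes c]
  exact RingQuot.mkAlgHom_rel k SphereRel.spin0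

theorem induction {P : Sphere q c → Prop}
    (h_scalar : ∀ r, P (algebraMap k _ r)) (h_gen : ∀ x, P (ι q c x))
    (h_mul : ∀ a b, P a → P b → P (a * b)) (h_add : ∀ a b, P a → P b → P (a + b)) (a) : P a := by
  obtain ⟨a, rfl⟩ : ∃ b, mk q c b = a := RingQuot.mkAlgHom_surjective k (SphereRel q c) a
  induction a using TensorAlgebra.induction with
  | algebraMap r => rw [AlgHom.commutes]; exact h_scalar r
  | ι x => exact h_gen x
  | mul a b ha hb => rw [map_mul]; exact h_mul _ _ ha hb
  | add a b ha hb => rw [map_add]; exact h_add _ _ ha hb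

end Sphere

theorem Uq.induction {q : kˣ} {P : Uq q → Prop}
    (h_scalar : ∀ r, P (algebraMap k _ r)) (h_gen : ∀ x, P (gen q x))
    (h_mul : ∀ a b, P a → P b → P (a * b)) (h_add : ∀ a b, P a → P b → P (a + b)) (a) : P a := by
  let mk : FreeAlgebra k UGen →ₐ[k] Uq q := RingQuot.mkAlgHom k (URel q)
  obtain ⟨a, rfl⟩ : ∃ b, mk b = a := RingQuot.mkAlgHom_surjective k (URel q) a
  induction a with
  | grade0 r => rw [AlgHom.commutes]; exact h_scalar r
  | grade1 x => exact h_gen x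
  | mul a b ha hb => rw [map_mul]; exact h_mul _ _ ha hb
  | add a b ha hb => rw [map_add]; exact h_add _ _ ha hb

theorem rhoV_gen (q : kˣ) (g : UGen) (x : V k) :
    rhoV q (Uq.gen q g) x = (matV q g).mulVec x := by
  simp [rhoV]

theorem rhoVV_X (q : kˣ) (x y : V k) : rhoVV q (Uq.gen q .X) (x ⊗ₜ y) =
    (matV q .X).mulVec x ⊗ₜ y + (matV q .Kinv).mulVec x ⊗ₜ (matV q .X).mulVec y := by
  simp [rhoVV, Uq.comulHom, Uq.comulGen, rhoV_gen, Module.endTensorEndAlgHom_apply]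

theorem rhoVV_Y (q : kˣ) (x y : V k) : rhoVV q (Uq.gen q .Y) (x ⊗ₜ y) =
    (matV q .Y).mulVec x ⊗ₜ (matV q .K).mulVec y + x ⊗ₜ (matV q .Y).mulVec y := by
  simp [rhoVV, Uq.comulHom, Uq.comulGen, rhoV_gen, Module.endTensorEndAlgHom_apply]

theorem rhoVV_K (q : kˣ) (x y : V k) : rhoVV q (Uq.gen q .K) (x ⊗ₜ y) =
    (matV q .K).mulVec x ⊗ₜ (matV q .K).mulVec y := by
  simp [rhoVV, Uq.comulHom, Uq.comulGen, rhoV_gen, Module.endTensorEndAlgHom_apply]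

theorem rhoVV_Kinv (q : kˣ) (x y : V k) : rhoVV q (Uq.gen q .Kinv) (x ⊗ₜ y) =
    (matV q .Kinv).mulVec x ⊗ₜ (matV q .Kinv).mulVec y := by
  simp [rhoVV, Uq.comulHom, Uq.comulGen, rhoV_gen, Module.endTensorEndAlgHom_apply]

theorem matV_u (q : kˣ) (g : UGen) : (matV q g).mulVec u = match g with
    | .X => 0 | .Y => -v | .K => (q : k) ^ 2 • u | .Kinv => ((q : k) ^ 2)⁻¹ • u := by
  cases g <;> ext i <;> fin_cases i <;> simp [matV, u, v]

theorem matV_v (q : kˣ) (g : UGen) : (matV q g).mulVec v = match g with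
    | .X => -((q : k) + (q : k)⁻¹) • u | .Y => ((q : k) + (q : k)⁻¹) • w
    | .K => v | .Kinv => v := by
  cases g <;> ext i <;> fin_cases i <;> simp [matV, u, v, w]

theorem matV_w (q : kˣ) (g : UGen) : (matV q g).mulVec w = match g with
    | .X => v | .Y => 0 | .K => ((q : k) ^ 2)⁻¹ • w | .Kinv => (q : k) ^ 2 • w := by
  cases g <;> ext i <;> fin_cases i <;> simp [matV, v, w]

theorem rhoVV_v0 (q : kˣ) (h : Uq q) :
    rhoVV q h (v0 q) = Coalgebra.counit (R := k) h • v0 q := by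
  have hq : (q : k) ≠ 0 := q.ne_zero
  induction h using Uq.induction with
  | h_scalar r => simp [Algebra.algebraMap_eq_smul_one]
  | h_gen x =>
    have hc : Coalgebra.counit (R := k) (Uq.gen q x) = Uq.counitHom q (Uq.gen q x) := rfl
    rw [hc]
    cases x <;>
    simp only [v0, map_add, map_smul, rhoVV_X, rhoVV_Y, rhoVV_K, rhoVV_Kinv, matV_u, matV_v,
      matV_w, Uq.counitHom, Uq.lift_gen, TensorProduct.zero_tmul, TensorProduct.tmul_zero,
      TensorProduct.neg_tmul, TensorProduct.tmul_neg, ← TensorProduct.smul_tmul',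
      TensorProduct.tmul_smul, zero_smul, one_smul, neg_smul] <;>
    match_scalars <;> field_simp <;> ring
  | h_mul a b ha hb =>
    rw [map_mul, Module.End.mul_apply, hb, map_smul, ha, smul_smul, Bialgebra.counit_mul, mul_comm]
  | h_add a b ha hb => simp [ha, hb, add_smul]

theorem rhoVV_V1 (q : kˣ) (h : Uq q) (x) (hx : x ∈ V1 q) : rhoVV q h x ∈ V1 q := by
  have hq : (q : k) ≠ 0 := q.ne_zero
  induction h using Uq.induction generalizing x with
  | h_scalar r => simpa [Algebra.algebraMap_eq_smul_one] using Submodule.smul_mem _ r hx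
  | h_gen g =>
    have m1 : (q : k) ^ 2 • (u ⊗ₜ v) - v ⊗ₜ u ∈ V1 q := Submodule.subset_span (by simp)
    have m2 : ((q : k) ^ 3 + q) • (u ⊗ₜ w - w ⊗ₜ u) + (1 - (q : k) ^ 2) • (v ⊗ₜ v) ∈ V1 q :=
      Submodule.subset_span (by simp)
    have m3 : w ⊗ₜ v - (q : k) ^ 2 • (v ⊗ₜ w) ∈ V1 q := Submodule.subset_span (by simp)
    have key (a b d : k) (y) (hy : y = a • ((q : k) ^ 2 • (u ⊗ₜ v) - v ⊗ₜ u) +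
        b • (((q : k) ^ 3 + q) • (u ⊗ₜ w - w ⊗ₜ u) + (1 - (q : k) ^ 2) • (v ⊗ₜ v)) +
        d • (w ⊗ₜ v - (q : k) ^ 2 • (v ⊗ₜ w))) : y ∈ V1 q := by
      rw [hy]
      exact add_mem (add_mem (Submodule.smul_mem _ _ m1) (Submodule.smul_mem _ _ m2))
        (Submodule.smul_mem _ _ m3)
    induction hx using Submodule.span_induction with
    | zero => rw [map_zero]; exact zero_mem _
    | add x y _ _ hx hy => rw [map_add]; exact add_mem hx hy
    | smul r x _ hx => rw [map_smul]; exact Submodule.smul_mem _ _ hx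
    | mem x hx =>
      obtain ⟨a, b, d, h⟩ : ∃ a b d : k, rhoVV q (Uq.gen q g) x =
          a • ((q : k) ^ 2 • (u ⊗ₜ v) - v ⊗ₜ u) +
          b • (((q : k) ^ 3 + q) • (u ⊗ₜ w - w ⊗ₜ u) + (1 - (q : k) ^ 2) • (v ⊗ₜ v)) +
          d • (w ⊗ₜ v - (q : k) ^ 2 • (v ⊗ₜ w)) := by
        rcases hx with rfl | rfl | rfl
        · refine ⟨match g with | .X => 0 | .Y => 0 | .K => (q : k) ^ 2 | .Kinv => ((q : k) ^ 2)⁻¹,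
            match g with | .X => 0 | .Y => 1 | .K => 0 | .Kinv => 0, 0, ?_⟩
          cases g <;>
          simp only [map_add, map_sub, map_smul, rhoVV_X, rhoVV_Y, rhoVV_K, rhoVV_Kinv, matV_u,
            matV_v, matV_w, TensorProduct.zero_tmul, TensorProduct.tmul_zero,
            TensorProduct.neg_tmul, TensorProduct.tmul_neg, ← TensorProduct.smul_tmul',
            TensorProduct.tmul_smul, zero_smul, one_smul, neg_smul] <;>
          match_scalars <;> field_simp <;> ring
        · refine ⟨match g with | .X => (q : k) + (q : k)⁻¹ | .Y => 0 | .K => 0 | .Kinv => 0,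
            match g with | .X => 0 | .Y => 0 | .K => 1 | .Kinv => 1,
            match g with | .X => 0 | .Y => (q : k) + (q : k)⁻¹ | .K => 0 | .Kinv => 0, ?_⟩
          cases g <;>
          simp only [map_add, map_sub, map_smul, rhoVV_X, rhoVV_Y, rhoVV_K, rhoVV_Kinv, matV_u,
            matV_v, matV_w, TensorProduct.zero_tmul, TensorProduct.tmul_zero,
            TensorProduct.neg_tmul, TensorProduct.tmul_neg, ← TensorProduct.smul_tmul',
            TensorProduct.tmul_smul, zero_smul, one_smul, neg_smul] <;>
          match_scalars <;> field_simp <;> ring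
        · refine ⟨0, match g with | .X => 1 | .Y => 0 | .K => 0 | .Kinv => 0,
            match g with | .X => 0 | .Y => 0 | .K => ((q : k) ^ 2)⁻¹ | .Kinv => (q : k) ^ 2, ?_⟩
          cases g <;>
          simp only [map_add, map_sub, map_smul, rhoVV_X, rhoVV_Y, rhoVV_K, rhoVV_Kinv, matV_u,
            matV_v, matV_w, TensorProduct.zero_tmul, TensorProduct.tmul_zero,
            TensorProduct.neg_tmul, TensorProduct.tmul_neg, ← TensorProduct.smul_tmul',
            TensorProduct.tmul_smul, zero_smul, one_smul, neg_smul] <;>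
          match_scalars <;> field_simp <;> ring
      exact key a b d _ h
  | h_mul a b ha hb => rw [map_mul]; exact ha _ (hb _ hx)
  | h_add a b ha hb => rw [map_add]; exact add_mem (ha _ hx) (hb _ hx)

namespace Sphere

variable (q : kˣ) (c : k)

/-- The map `x ↦ (h ↦ h.x)` on `V`, with values in the quantum sphere. -/
def actionV : V k →ₗ[k] WithConv (Uq q →ₗ[k] Sphere q c) :=
  (WithConv.linearEquiv k (Uq q →ₗ[k] Sphere q c)).symm.toLinearMap ∘ₗ
    ((rhoV q).toLinearMap.compr₂ (ι q c)).flip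

theorem mul2_actionV (x) (h : Uq q) :
    (mul2 (actionV q c) x).ofConv h = mul2 (ι q c) (rhoVV q h x) := by
  induction x with
  | zero => simp
  | add x y hx hy => simp [hx, hy]
  | tmul x y =>
    have key (t : Uq q ⊗[k] Uq q) :
        LinearMap.mul' k _ (TensorProduct.map (actionV q c x).ofConv (actionV q c y).ofConv t) =
        mul2 (ι q c) (Module.endTensorEndAlgHom (R := k) (S := k) (A := k)
          (Algebra.TensorProduct.map (rhoV q) (rhoV q) t) (x ⊗ₜ y)) := by
      induction t with
      | zero => simp
      | add s t hs ht => simp [hs, ht]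
      | tmul s t => simp [mul2, actionV, Module.endTensorEndAlgHom_apply]
    exact key _

/-- The action of `U_q(sl(2))` on the quantum sphere, written `a ↦ (h ↦ h.a)`. The extension of the
action from `V` to products through the coproduct, `h.(a b) = ∑ (h₁.a) (h₂.b)` and
`h.1 = ε(h) 1`, says exactly that this map is an algebra map to the convolution algebra of linear
maps from `U_q(sl(2))` to the quantum sphere. -/
def coaction : Sphere q c →ₐ[k] WithConv (Uq q →ₗ[k] Sphere q c) :=
  lift q c (actionV q c)
    (by
      intro x hx
      ext h
      exact (mul2_actionV q c x h).trans (mul2_V1 (rhoVV_V1 q h x hx)))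
    (by
      ext h
      refine (mul2_actionV q c _ h).trans ?_
      rw [rhoVV_v0, map_smul, mul2_v0]
      simp [Algebra.algebraMap_eq_smul_one, smul_smul, mul_comm])

/-- The element `h.a` of the quantum sphere, linearly in `h` and `a`. -/
def smulMap : Uq q →ₗ[k] Module.End k (Sphere q c) :=
  ((WithConv.linearEquiv k (Uq q →ₗ[k] Sphere q c)).toLinearMap ∘ₗ
    (coaction q c).toLinearMap).flip

variable {q c}

theorem smulMap_ι (h : Uq q) (x : V k) : smulMap q c h (ι q c x) = ι q c (rhoV q h x) := by
  simp [smulMap, coaction, actionV]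

theorem smulMap_algebraMap (h : Uq q) (r : k) : smulMap q c h (algebraMap k _ r) =
    Coalgebra.counit (R := k) h • algebraMap k _ r := by
  simp [smulMap, Algebra.algebraMap_eq_smul_one, smul_smul, mul_comm]

/-- The product of the quantum sphere is compatible with the coproduct. -/
theorem smulMap_mul (h : Uq q) (a b : Sphere q c) : smulMap q c h (a * b) = LinearMap.mul' k _
    (TensorProduct.map ((smulMap q c).flip a) ((smulMap q c).flip b)
      (Coalgebra.comul (R := k) h)) := by
  simp [smulMap]

theorem smulMap_one : smulMap q c 1 = 1 := by
  ext a
  induction a using Sphere.induction with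
  | h_scalar r => simp [smulMap_algebraMap]
  | h_gen x => simp [smulMap_ι]
  | h_add a b ha hb => simp [ha, hb]
  | h_mul a b ha hb =>
    simp [smulMap_mul, Bialgebra.comul_one, Algebra.TensorProduct.one_def, ha, hb]

theorem smulMap_mul_left (g h : Uq q) : smulMap q c (g * h) = smulMap q c g * smulMap q c h := by
  ext a
  induction a using Sphere.induction generalizing g h with
  | h_scalar r => simp [smulMap_algebraMap, smul_smul, mul_comm]
  | h_gen x => simp [smulMap_ι]
  | h_add a b ha hb => simp [ha, hb]
  | h_mul a b ha hb =>
    have h₁ (s₁ s₂ : Uq q) (r : Uq q ⊗[k] Uq q) :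
        LinearMap.mul' k _ (TensorProduct.map ((smulMap q c).flip a) ((smulMap q c).flip b)
          (r * s₁ ⊗ₜ s₂)) =
        LinearMap.mul' k _ (TensorProduct.map ((smulMap q c).flip (smulMap q c s₁ a))
          ((smulMap q c).flip (smulMap q c s₂ b)) r) := by
      induction r with
      | zero => simp
      | add x y hx hy => simp only [add_mul, map_add, hx, hy]
      | tmul x y => simp [ha, hb]
    have h₂ (t : Uq q ⊗[k] Uq q) :
        LinearMap.mul' k _ (TensorProduct.map ((smulMap q c).flip a) ((smulMap q c).flip b)
          (Coalgebra.comul (R := k) g * t)) =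
        smulMap q c g (LinearMap.mul' k _
          (TensorProduct.map ((smulMap q c).flip a) ((smulMap q c).flip b) t)) := by
      induction t with
      | zero => simp
      | add x y hx hy => simp only [mul_add, map_add, hx, hy]
      | tmul x y => simp [h₁, smulMap_mul]
    rw [smulMap_mul, Bialgebra.comul_mul, h₂, Module.End.mul_apply, smulMap_mul]

variable (q c) in
/-- The action of `U_q(sl(2))` on the quantum sphere. -/
def act : Uq q →ₐ[k] Module.End k (Sphere q c) :=
  AlgHom.ofLinearMap (smulMap q c) smulMap_one smulMap_mul_left

variable (q c) in
/-- The operator by which `X` acts on the quantum sphere. -/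
def opX : Module.End k (Sphere q c) := act q c (Uq.gen q .X)

variable (q c) in
/-- The operator by which `Y` acts on the quantum sphere. -/
def opY : Module.End k (Sphere q c) := act q c (Uq.gen q .Y)

variable (q c) in
/-- The operator by which `K⁻¹` acts on the quantum sphere. -/
def opKinv : Module.End k (Sphere q c) := act q c (Uq.gen q .Kinv)

theorem act_apply (h : Uq q) : act q c h = smulMap q c h := rfl

theorem opX_mul (a b : Sphere q c) :
    opX q c (a * b) = opX q c a * b + opKinv q c a * opX q c b := by
  simp [opX, opKinv, act_apply, smulMap_mul, Uq.comul_gen, Uq.comulGen, smulMap_one]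

theorem opX_opKinv : opX q c * opKinv q c = (q : k) ^ 2 • (opKinv q c * opX q c) := by
  rw [opX, opKinv, ← map_mul, ← map_mul, Uq.X_Kinv, map_smul]

theorem opX_pow_opKinv (n : ℕ) (a : Sphere q c) (h : (opX q c ^ n) a = 0) :
    (opX q c ^ n) (opKinv q c a) = 0 := by
  have H : ∃ r : k, opX q c ^ n * opKinv q c = r • (opKinv q c * opX q c ^ n) := by
    clear h
    induction n with
    | zero => exact ⟨1, by simp⟩
    | succ n ih =>
      obtain ⟨r, hr⟩ := ih
      refine ⟨(q : k) ^ 2 * r, ?_⟩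
      rw [pow_succ, mul_assoc, opX_opKinv, mul_smul_comm, ← mul_assoc, hr, smul_mul_assoc,
        mul_assoc, smul_smul]
  obtain ⟨r, hr⟩ := H
  rw [← Module.End.mul_apply, hr, LinearMap.smul_apply, Module.End.mul_apply, h, map_zero,
    smul_zero]

theorem opX_pow_mul (N : ℕ) : ∀ (m n : ℕ) (a b : Sphere q c), m + n = N →
    (opX q c ^ m) a = 0 → (opX q c ^ n) b = 0 → (opX q c ^ N) (a * b) = 0 := by
  induction N with
  | zero =>
    intro m n a b h ha hb
    obtain rfl : m = 0 := by omega
    simp at ha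
    simp [ha]
  | succ N ih =>
    intro m n a b h ha hb
    rw [pow_succ, Module.End.mul_apply, opX_mul, map_add]
    have h₁ : (opX q c ^ N) (opX q c a * b) = 0 := by
      rcases m with _ | m
      · simp at ha
        simp [ha]
      · exact ih m n _ _ (by omega) (by rwa [pow_succ] at ha) hb
    have h₂ : (opX q c ^ N) (opKinv q c a * opX q c b) = 0 := by
      rcases n with _ | n
      · simp at hb
        simp [hb]
      · exact ih m n _ _ (by omega) (opX_pow_opKinv m a ha) (by rwa [pow_succ] at hb)
    rw [h₁, h₂, add_zero]

theorem opX_pow_add {N n : ℕ} (h : N ≤ n) (a : Sphere q c) (ha : (opX q c ^ N) a = 0) :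
    (opX q c ^ n) a = 0 := by
  obtain ⟨m, rfl⟩ := Nat.exists_eq_add_of_le' h
  rw [pow_add, Module.End.mul_apply, ha, map_zero]

/-- `X` acts locally nilpotently on the quantum sphere. -/
theorem exists_opX_pow_eq_zero (a : Sphere q c) : ∃ N : ℕ, (opX q c ^ N) a = 0 := by
  induction a using Sphere.induction with
  | h_scalar r =>
    refine ⟨1, ?_⟩
    have : Coalgebra.counit (R := k) (Uq.gen q .X) = 0 := Uq.lift_gen _ _ _ _ _ _ _
    simp [opX, act_apply, smulMap_algebraMap, this]
  | h_gen x =>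
    refine ⟨3, ?_⟩
    have : ((rhoV q) (Uq.gen q .X)) (((rhoV q) (Uq.gen q .X)) (((rhoV q) (Uq.gen q .X)) x)) = 0 := by
      ext i
      fin_cases i <;> simp [rhoV_gen, matV, Matrix.mulVec, dotProduct, Fin.sum_univ_three]
    simp [opX, act_apply, pow_succ, smulMap_ι, this]
  | h_add a b ha hb =>
    obtain ⟨m, hm⟩ := ha
    obtain ⟨n, hn⟩ := hb
    exact ⟨m + n, by rw [map_add, opX_pow_add (by omega) a hm, opX_pow_add (by omega) b hn,
      add_zero]⟩
  | h_mul a b ha hb =>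
    obtain ⟨m, hm⟩ := ha
    obtain ⟨n, hn⟩ := hb
    exact ⟨m + n, opX_pow_mul _ m n a b rfl hm hn⟩

variable (q c) in
/-- The weight components of the elements of `V`: for `x = x₀ u + x₁ v + x₂ w`, the coefficients at
`1`, `0`, `-1` are `x₀ u`, `x₁ v`, `x₂ w`, of weights (eigenvalues of `H`) `2`, `0`, `-2`. -/
def weightsV : V k →ₗ[k] AddMonoidAlgebra (Sphere q c) ℤ where
  toFun x := .single 1 (x 0 • ι q c u) + .single 0 (x 1 • ι q c v) + .single (-1) (x 2 • ι q c w)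
  map_add' x y := by
    simp only [Pi.add_apply, add_smul, AddMonoidAlgebra.single_add]
    abel
  map_smul' r x := by
    simp only [Pi.smul_apply, smul_eq_mul, mul_smul, RingHom.id_apply, smul_add,
      AddMonoidAlgebra.smul_single]

theorem weightsV_u : weightsV q c u = .single 1 (ι q c u) := by
  simp [weightsV, u, -LaurentPolynomial.single_eq_C_mul_T,
    AddMonoidAlgebra.single_zero]

theorem weightsV_v : weightsV q c v = .single 0 (ι q c v) := by
  simp [weightsV, v, -LaurentPolynomial.single_eq_C_mul_T,
    AddMonoidAlgebra.single_zero]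

theorem weightsV_w : weightsV q c w = .single (-1) (ι q c w) := by
  simp [weightsV, w, -LaurentPolynomial.single_eq_C_mul_T,
    AddMonoidAlgebra.single_zero]

theorem mul2_weightsV (x y : V k) (i j : ℤ) (hx : weightsV q c x = .single i (ι q c x))
    (hy : weightsV q c y = .single j (ι q c y)) :
    mul2 (weightsV q c) (x ⊗ₜ y) = .single (i + j) (mul2 (ι q c) (x ⊗ₜ y)) := by
  simp only [mul2, LinearMap.comp_apply, TensorProduct.map_tmul, LinearMap.mul'_apply, hx, hy,
    AddMonoidAlgebra.single_mul_single]

theorem mul2_weightsV_V1 (x) (hx : x ∈ V1 q) : mul2 (weightsV q c) x = 0 := by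
  induction hx using Submodule.span_induction with
  | zero => simp
  | add x y _ _ hx hy => rw [map_add, hx, hy, add_zero]
  | smul r x _ hx => rw [map_smul, hx, smul_zero]
  | mem x hx =>
    have h : mul2 (ι q c) x = 0 := mul2_V1 (Submodule.subset_span hx)
    have huv := mul2_weightsV _ _ _ _ (weightsV_u (q := q) (c := c)) weightsV_v
    have hvu := mul2_weightsV _ _ _ _ (weightsV_v (q := q) (c := c)) weightsV_u
    have huw := mul2_weightsV _ _ _ _ (weightsV_u (q := q) (c := c)) weightsV_w
    have hwu := mul2_weightsV _ _ _ _ (weightsV_w (q := q) (c := c)) weightsV_u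
    have hvv := mul2_weightsV _ _ _ _ (weightsV_v (q := q) (c := c)) weightsV_v
    have hwv := mul2_weightsV _ _ _ _ (weightsV_w (q := q) (c := c)) weightsV_v
    have hvw := mul2_weightsV _ _ _ _ (weightsV_v (q := q) (c := c)) weightsV_w
    rcases hx with rfl | rfl | rfl <;>
    simp only [map_add, map_sub, map_smul, huv, hvu, huw, hwu, hvv, hwv, hvw,
      AddMonoidAlgebra.smul_single, ← AddMonoidAlgebra.single_add,
      ← AddMonoidAlgebra.single_sub, add_zero, zero_add, add_neg_cancel, neg_add_cancel] at h ⊢ <;>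
    rw [h, AddMonoidAlgebra.single_zero]

theorem mul2_weightsV_v0 : mul2 (weightsV q c) (v0 q) = algebraMap k _ c := by
  have h : mul2 (ι q c) (v0 q) = _ := mul2_v0
  have huw := mul2_weightsV _ _ _ _ (weightsV_u (q := q) (c := c)) weightsV_w
  have hwu := mul2_weightsV _ _ _ _ (weightsV_w (q := q) (c := c)) weightsV_u
  have hvv := mul2_weightsV _ _ _ _ (weightsV_v (q := q) (c := c)) weightsV_v
  simp only [v0, map_add, map_smul, huw, hwu, hvv,
    AddMonoidAlgebra.smul_single, ← AddMonoidAlgebra.single_add,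
    add_zero, add_neg_cancel, neg_add_cancel] at h ⊢
  rw [h]
  rfl

variable (q c) in
/-- The weight decomposition of the quantum sphere. `H` acts as a derivation, so weights add up
under products: the decomposition is an algebra map to Laurent polynomials over the quantum sphere,
and the coefficient of `a` at `i` is the component of `a` of weight `2 i`. -/
def weights : Sphere q c →ₐ[k] AddMonoidAlgebra (Sphere q c) ℤ :=
  lift q c (weightsV q c) mul2_weightsV_V1 mul2_weightsV_v0

variable (q c) in
/-- The projection to the subspace of weight `2 i`, the eigenspace of `H` for the eigenvalue
`2 i`. -/
def weightProj (i : ℤ) : Module.End k (Sphere q c) where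
  toFun a := (weights q c a).coeff i
  map_add' a b := by simp
  map_smul' r a := by simp

theorem finite_weightProj (a : Sphere q c) : {i | weightProj q c i a ≠ 0}.Finite :=
  (weights q c a).coeff.hasFiniteSupport

/-- `K = q ^ H` acts on the subspace of weight `2 i` by `q ^ (2 i)`. -/
theorem act_K_weightProj (i : ℤ) (a : Sphere q c) :
    act q c (Uq.gen q .K) (weightProj q c i a) = (q : k) ^ (2 * i) • weightProj q c i a := by
  have hq : (q : k) ≠ 0 := q.ne_zero
  have hK (a b : Sphere q c) : act q c (Uq.gen q .K) (a * b) =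
      act q c (Uq.gen q .K) a * act q c (Uq.gen q .K) b := by
    simp [act_apply, smulMap_mul, Uq.comul_gen, Uq.comulGen]
  have h1 (r : k) : act q c (Uq.gen q .K) (algebraMap k _ r) = algebraMap k _ r := by
    have : Coalgebra.counit (R := k) (Uq.gen q .K) = 1 := Uq.lift_gen _ _ _ _ _ _ _
    simp [act_apply, smulMap_algebraMap, this]
  change act q c (Uq.gen q .K) ((weights q c a).coeff i) = _ • (weights q c a).coeff i
  induction a using Sphere.induction generalizing i with
  | h_scalar r =>
    rw [AlgHom.commutes]
    have : algebraMap k (AddMonoidAlgebra (Sphere q c) ℤ) r = .single 0 (algebraMap k _ r) := rfl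
    rw [this, AddMonoidAlgebra.coeff_single, Finsupp.single_apply]
    split_ifs with h
    · subst h; simp [h1]
    · simp
  | h_gen x =>
    have hu : act q c (Uq.gen q .K) (ι q c u) = (q : k) ^ 2 • ι q c u := by
      rw [act_apply, smulMap_ι, rhoV_gen, matV_u, map_smul]
    have hv : act q c (Uq.gen q .K) (ι q c v) = ι q c v := by
      rw [act_apply, smulMap_ι, rhoV_gen, matV_v]
    have hw : act q c (Uq.gen q .K) (ι q c w) = ((q : k) ^ 2)⁻¹ • ι q c w := by
      rw [act_apply, smulMap_ι, rhoV_gen, matV_w, map_smul]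
    simp only [weights, lift_ι, weightsV, LinearMap.coe_mk, AddHom.coe_mk,
      AddMonoidAlgebra.coeff_add, AddMonoidAlgebra.coeff_single, Finsupp.add_apply,
      Finsupp.single_apply, map_add, smul_add]
    congr 1
    · congr 1
      · split_ifs with h
        · subst h; rw [map_smul, hu, smul_comm]; norm_cast
        · simp
      · split_ifs with h
        · subst h; simp [hv]
        · simp
    · split_ifs with h
      · subst h; rw [map_smul, hw, smul_comm]; norm_cast
      · simp
  | h_add a b ha hb => simp [ha, hb]
  | h_mul a b ha hb =>
    rw [map_mul, AddMonoidAlgebra.coeff_mul]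
    simp only [Finsupp.sum, map_sum, Finset.smul_sum]
    refine Finset.sum_congr rfl fun m _ => Finset.sum_congr rfl fun n _ => ?_
    split_ifs with h
    · subst h
      rw [hK, ha, hb, smul_mul_smul_comm, ← zpow_add₀ hq, mul_add]
    · simp

/-- Every element is the sum of its weight components. -/
theorem finsum_weightProj (a : Sphere q c) : ∑ᶠ i, weightProj q c i a = a := by
  let g : AddMonoidAlgebra (Sphere q c) ℤ →ₐ[k] Sphere q c :=
    AddMonoidAlgebra.liftNCAlgHom (AlgHom.id k _) 1 (fun _ _ => Commute.one_right _)
  have hs (i : ℤ) (b : Sphere q c) : g (.single i b) = b := by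
    simp [g, AddMonoidAlgebra.liftNCAlgHom, -LaurentPolynomial.single_eq_C_mul_T]
  have hg (x : AddMonoidAlgebra (Sphere q c) ℤ) : g x = ∑ᶠ i, x.coeff i := by
    rw [finsum_eq_sum_of_support_subset (s := x.coeff.support) _ (by simp)]
    conv_lhs => rw [← AddMonoidAlgebra.sum_coeff_single x]
    simp [Finsupp.sum, hs, -LaurentPolynomial.single_eq_C_mul_T]
  refine (hg (weights q c a)).symm.trans ?_
  induction a using Sphere.induction with
  | h_scalar r => rw [AlgHom.commutes, AlgHom.commutes]
  | h_gen x =>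
    have hx : x = x 0 • u + x 1 • v + x 2 • w := by
      ext i
      fin_cases i <;> simp [u, v, w]
    conv_rhs => rw [hx]
    simp only [weights, lift_ι, weightsV, LinearMap.coe_mk, AddHom.coe_mk, map_add, hs, map_smul]
  | h_add a b ha hb => simp [ha, hb]
  | h_mul a b ha hb => simp [ha, hb]

end Sphere

/-- The pointwise sum of a family of linear maps of which all but finitely many vanish at any given
vector. -/
def locallyFiniteSum {ι M N : Type*} [AddCommGroup M] [Module k M] [AddCommGroup N] [Module k N]
    (f : ι → M →ₗ[k] N) (hf : ∀ x, {i | f i x ≠ 0}.Finite) : M →ₗ[k] N where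
  toFun x := ∑ᶠ i, f i x
  map_add' x y := by
    simp only [map_add]
    exact finsum_add_distrib (hf x) (hf y)
  map_smul' r x := by
    simp only [map_smul, RingHom.id_apply]
    exact (smul_finsum' r (hf x)).symm

/-- The `q`-integer `[n] = (qⁿ - q⁻ⁿ) / (q - q⁻¹)`. -/
def qInt (q : kˣ) (n : ℕ) : k := ((q : k) ^ n - (q : k)⁻¹ ^ n) / ((q : k) - (q : k)⁻¹)

/-- The `q`-factorial `[n]! = [1] [2] ⋯ [n]`. -/
def qFactorial (q : kˣ) (n : ℕ) : k := ∏ i ∈ Finset.range n, qInt q (i + 1)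

/-- The coefficient `q ^ (n (n - 1) / 2) (q - q⁻¹) ^ n / [n]!` of `Xⁿ ⊗ Yⁿ` in the universal
`R`-matrix. -/
def coeffR (q : kˣ) (n : ℕ) : k :=
  (q : k) ^ (n * (n - 1) / 2) * ((q : k) - (q : k)⁻¹) ^ n / qFactorial q n

namespace Sphere

variable (q : kˣ) (c : k)

/-- The action of `q ^ (H ⊗ H / 2)` on the tensor square of the quantum sphere: the scalar
`q ^ ((2 i) (2 j) / 2)` on the tensor product of the subspaces of weights `2 i` and `2 j`. -/
def cartanPart : Module.End k (Sphere q c ⊗[k] Sphere q c) :=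
  locallyFiniteSum (ι := ℤ × ℤ)
    (fun p => (q : k) ^ (2 * p.1 * p.2) •
      TensorProduct.map (weightProj q c p.1) (weightProj q c p.2))
    (by
      intro t
      induction t with
      | zero => simp
      | add s t hs ht =>
        refine (hs.union ht).subset fun p hp => ?_
        by_contra h
        simp only [Set.mem_union, Set.mem_ofPred_eq, not_or, not_not] at h
        exact hp (by rw [map_add, h.1, h.2, add_zero])
      | tmul a b =>
        refine ((finite_weightProj a).prod (finite_weightProj b)).subset fun p hp => ?_
        refine ⟨fun h => hp ?_, fun h => hp ?_⟩ <;> simp [h])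

/-- The action of `∑ₙ q ^ (n (n - 1) / 2) (q - q⁻¹) ^ n / [n]! Xⁿ ⊗ Yⁿ` on the tensor square of the
quantum sphere. -/
def unipotentPart : Module.End k (Sphere q c ⊗[k] Sphere q c) :=
  locallyFiniteSum (ι := ℕ)
    (fun n => coeffR q n • TensorProduct.map (opX q c ^ n) (opY q c ^ n))
    (by
      intro t
      induction t with
      | zero => simp
      | add s t hs ht =>
        refine (hs.union ht).subset fun p hp => ?_
        by_contra h
        simp only [Set.mem_union, Set.mem_ofPred_eq, not_or, not_not] at h
        exact hp (by rw [map_add, h.1, h.2, add_zero])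
      | tmul a b =>
        obtain ⟨N, hN⟩ := exists_opX_pow_eq_zero a
        refine (Set.finite_lt_nat N).subset fun n hn => ?_
        by_contra h
        simp only [Set.mem_ofPred_eq, not_lt] at h
        exact hn (by simp [opX_pow_add h a hN]))

/-- The action on the tensor square of the quantum sphere of the universal `R`-matrix of
`U_q(sl(2))`,
`R = (∑ₙ q ^ (n (n - 1) / 2) (q - q⁻¹) ^ n / [n]! Xⁿ ⊗ Yⁿ) q ^ (H ⊗ H / 2)`. -/
def actR : Module.End k (Sphere q c ⊗[k] Sphere q c) := unipotentPart q c * cartanPart q c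

/-- The braiding `S = σ R`, where `σ` is the flip. -/
def braiding : Module.End k (Sphere q c ⊗[k] Sphere q c) :=
  (TensorProduct.comm k (Sphere q c) (Sphere q c)).toLinearMap ∘ₗ actR q c

end Sphere

section Legs

variable {A : Type*} [Ring A] [Algebra k A]

/-- An operator on `A ⊗ A`, applied to the first and second factors of `A ⊗ A ⊗ A`. -/
def op12 (T : Module.End k (A ⊗[k] A)) : Module.End k (A ⊗[k] A ⊗[k] A) := T.rTensor A

/-- An operator on `A ⊗ A`, applied to the second and third factors of `A ⊗ A ⊗ A`. -/
def op23 (T : Module.End k (A ⊗[k] A)) : Module.End k (A ⊗[k] A ⊗[k] A) :=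
  (TensorProduct.assoc k A A A).symm.toLinearMap ∘ₗ T.lTensor A ∘ₗ
    (TensorProduct.assoc k A A A).toLinearMap

variable (k A) in
/-- The product applied to the first and second factors of `A ⊗ A ⊗ A`. -/
def mul12 : A ⊗[k] A ⊗[k] A →ₗ[k] A ⊗[k] A := (LinearMap.mul' k A).rTensor A

variable (k A) in
/-- The product applied to the second and third factors of `A ⊗ A ⊗ A`. -/
def mul23 : A ⊗[k] A ⊗[k] A →ₗ[k] A ⊗[k] A :=
  (LinearMap.mul' k A).lTensor A ∘ₗ (TensorProduct.assoc k A A A).toLinearMap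

end Legs

end QSphere

end

/-! The two identities for `S` are the relations (Δ ⊗ id)R = R₁₃R₂₃ and (id ⊗ Δ)R = R₁₃R₁₂ seen
through the action: on a module algebra, moving R past the product applies Δ to one leg of R. Since
R exists only as a locally finite sum of operators, everything is checked on tensors of eigenvectors
of K, where the Cartan part is a scalar and the unipotent part a finite sum.

Write c_n for `coeffR q n`. The quotient c_{n-1}/c_n is, up to a constant factor, the integer n
deformed at q⁻², so ∑ c_n zⁿ is a q-exponential: if ab = q²ba, then c_n(a + b)ⁿ = ∑ c_i c_j aⁱbʲ
over i + j = n (`coeffR_smul_add_pow`). The summands X ⊗ 1, K⁻¹ ⊗ X of Δ(X), and 1 ⊗ Y, Y ⊗ K of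
Δ(Y) in this order, q-commute in this way, which expands c_n Xⁿ and c_n Yⁿ on a product
(`coeffR_smul_opX_pow_mul`, `coeffR_smul_opY_pow_mul`). It remains to compare powers of q: the
powers of K left by the coproduct account exactly for the weight shift that the first braiding
causes in the second one (`braiding_mul12`, `braiding_mul23`).

`S` is invertible because the Cartan part is diagonal with nonzero eigenvalues and the unipotent
part is a power series with constant term 1 in the locally nilpotent operator X ⊗ Y. The identities
for the inverse are then formal: inverting one identity for `S` gives the other one for S⁻¹. That q
is not a root of unity makes the q-factorials nonzero and the eigenvalues of K on different weights
distinct. -/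

open scoped TensorProduct

noncomputable section

namespace QSphere

variable {k : Type*} [Field k]

/-! ### Coefficients of the R-matrix and the q-binomial theorem -/

section Coefficients

/-- The ratio of successive coefficients of the universal `R`-matrix. -/
def ratioR (q : kˣ) (n : ℕ) : k :=
  ((q : k) - (q : k) * ((q : k)⁻¹ ^ 2) ^ n) / ((q : k) - (q : k)⁻¹) ^ 2

theorem ratioR_zero (q : kˣ) : ratioR q 0 = 0 := by simp [ratioR]

/-- This is the q-Pascal rule: it drives the induction step of the q-binomial theorem. -/
theorem ratioR_add (q : kˣ) (m n : ℕ) :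
    ratioR q (m + n) = ((q : k)⁻¹ ^ 2) ^ n * ratioR q m + ratioR q n := by
  simp only [ratioR, pow_add]
  ring

variable {q : kˣ} (hq : ∀ n : ℕ, 0 < n → q ^ n ≠ 1)

include hq

/-- Otherwise q²ⁿ = 1. Hence no q-integer of positive index vanishes. -/
theorem pow_sub_inv_pow_ne_zero {n : ℕ} (hn : 0 < n) : (q : k) ^ n - (q : k)⁻¹ ^ n ≠ 0 := by
  intro h
  refine hq (n + n) (by omega) (Units.ext ?_)
  have h' : (q : k) ^ n = (q : k)⁻¹ ^ n := sub_eq_zero.mp h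
  rw [Units.val_pow_eq_pow_val, pow_add]
  nth_rewrite 1 [h']
  rw [← mul_pow, inv_mul_cancel₀ q.ne_zero, one_pow, Units.val_one]

theorem sub_inv_ne_zero : (q : k) - (q : k)⁻¹ ≠ 0 := by
  simpa using pow_sub_inv_pow_ne_zero hq one_pos

theorem ratioR_succ_ne_zero (n : ℕ) : ratioR q (n + 1) ≠ 0 := by
  refine div_ne_zero ?_ (pow_ne_zero 2 (sub_inv_ne_zero hq))
  have h := pow_sub_inv_pow_ne_zero hq n.succ_pos
  have h0 : (q : k) ≠ 0 := q.ne_zero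
  have e : (q : k) - (q : k) * ((q : k)⁻¹ ^ 2) ^ (n + 1) =
      (q : k) * (q : k)⁻¹ ^ (n + 1) * ((q : k) ^ (n + 1) - (q : k)⁻¹ ^ (n + 1)) := by
    have : (q : k)⁻¹ ^ (n + 1) * (q : k) ^ (n + 1) = 1 := by
      rw [← mul_pow, inv_mul_cancel₀ h0, one_pow]
    linear_combination (-(q : k)) * this
  rw [e]
  exact mul_ne_zero (mul_ne_zero h0 (pow_ne_zero _ (inv_ne_zero h0))) h

theorem ratioR_mul_coeffR (n : ℕ) : ratioR q (n + 1) * coeffR q (n + 1) = coeffR q n := by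
  have h0 : (q : k) ≠ 0 := q.ne_zero
  have h1 := sub_inv_ne_zero hq
  have h2 := pow_sub_inv_pow_ne_zero hq n.succ_pos
  have hf (m : ℕ) : qFactorial q m ≠ 0 :=
    Finset.prod_ne_zero_iff.mpr fun i _ =>
      div_ne_zero (pow_sub_inv_pow_ne_zero hq i.succ_pos) h1
  -- Triangular numbers are handled as binomial coefficients, which avoids the truncating division.
  have ht : (n + 1) * (n + 1 - 1) / 2 = n * (n - 1) / 2 + n := by
    rw [← Nat.choose_two_right, ← Nat.choose_two_right, Nat.choose_succ_succ' n 1]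
    simp [add_comm]
  have hs : qFactorial q (n + 1) = qFactorial q n * qInt q (n + 1) := Finset.prod_range_succ _ _
  have e : (q : k) - (q : k) * ((q : k)⁻¹ ^ 2) ^ (n + 1) =
      (q : k)⁻¹ ^ n * ((q : k) ^ (n + 1) - (q : k)⁻¹ ^ (n + 1)) := by
    have h3 : (q : k)⁻¹ ^ n * (q : k) ^ n = 1 := by
      rw [← mul_pow, inv_mul_cancel₀ h0, one_pow]
    have h4 : (q : k) * (q : k)⁻¹ = 1 := mul_inv_cancel₀ h0
    rw [pow_succ, pow_succ, pow_succ]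
    linear_combination (-(q : k)) * h3 - (q : k)⁻¹ * ((q : k)⁻¹ ^ n) ^ 2 * h4
  have h5 : (q : k)⁻¹ ^ n * (q : k) ^ n = 1 := by
    rw [← mul_pow, inv_mul_cancel₀ h0, one_pow]
  rw [ratioR, e, coeffR, coeffR, ht, hs, qInt, pow_add (q : k) (n * (n - 1) / 2) n, pow_succ ((q : k) - (q : k)⁻¹)]
  -- With the powers abstracted, the only relation still needed is q⁻ⁿqⁿ = 1.
  generalize (q : k) ^ (n + 1) - (q : k)⁻¹ ^ (n + 1) = s at *
  generalize (q : k) - (q : k)⁻¹ = d at *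
  generalize (q : k) ^ (n * (n - 1) / 2) = r at *
  have := hf n
  generalize qFactorial q n = F at *
  generalize (q : k)⁻¹ ^ n = y at *
  generalize (q : k) ^ n = x at *
  field_simp
  linear_combination r * d * d ^ n * h5

/-- The `q`-binomial theorem, for the coefficients of the universal `R`-matrix in place of inverse
`q`-factorials. -/
theorem coeffR_smul_add_pow {B : Type*} [Ring B] [Algebra k B] {a b : B}
    (hab : a * b = (q : k) ^ 2 • (b * a)) (n : ℕ) :
    coeffR q n • (a + b) ^ n =
      ∑ x ∈ Finset.HasAntidiagonal.antidiagonal n, (coeffR q x.1 * coeffR q x.2) • (a ^ x.1 * b ^ x.2) := by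
  have h0 : (q : k) ≠ 0 := q.ne_zero
  have hba : b * a = ((q : k)⁻¹ ^ 2) • (a * b) := by
    rw [hab, smul_smul, ← mul_pow, inv_mul_cancel₀ h0, one_pow, one_smul]
  have hpow (p : ℕ) : b ^ p * a = ((q : k)⁻¹ ^ 2) ^ p • (a * b ^ p) := by
    induction p with
    | zero => simp
    | succ p ih =>
      rw [pow_succ, mul_assoc, hba, mul_smul_comm, ← mul_assoc, ih, smul_mul_assoc, smul_smul,
        mul_assoc, ← pow_succ, ← pow_succ']
  induction n with
  | zero => simp [coeffR, qFactorial]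
  | succ n ih =>
    -- Multiplying by the nonzero ratio c_n/c_{n+1} turns the left side into c_n(a + b)ⁿ(a + b), to
    -- which the induction hypothesis applies.
    refine smul_right_injective B (ratioR_succ_ne_zero hq n) ?_
    simp only
    rw [smul_smul, ratioR_mul_coeffR hq, pow_succ, ← smul_mul_assoc, ih, Finset.smul_sum]
    -- By q-Pascal, the first part collects the terms whose last factor is a, with the cost of
    -- moving it left past the power of b, and the second part those whose last factor is b. Each
    -- ratio lowers one index by one, and `ratioR_zero` removes the boundary terms.
    have split : ∀ x ∈ Finset.HasAntidiagonal.antidiagonal (n + 1),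
        ratioR q (n + 1) • (coeffR q x.1 * coeffR q x.2) • (a ^ x.1 * b ^ x.2) =
        (((q : k)⁻¹ ^ 2) ^ x.2 * (ratioR q x.1 * coeffR q x.1) * coeffR q x.2) •
            (a ^ x.1 * b ^ x.2) +
          (coeffR q x.1 * (ratioR q x.2 * coeffR q x.2)) • (a ^ x.1 * b ^ x.2) := by
      intro x hx
      rw [← Finset.HasAntidiagonal.mem_antidiagonal.mp hx, ratioR_add, smul_smul, ← add_smul]
      congr 1
      ring
    rw [Finset.sum_congr rfl split, Finset.sum_add_distrib, Finset.Nat.sum_antidiagonal_succ,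
      Finset.Nat.sum_antidiagonal_succ', Finset.sum_mul]
    simp only [ratioR_zero, zero_mul, mul_zero, zero_smul, zero_add,
      ratioR_mul_coeffR hq]
    rw [← Finset.sum_add_distrib]
    refine Finset.sum_congr rfl fun x _ => ?_
    rw [mul_add, smul_mul_assoc, smul_mul_assoc, mul_assoc, hpow, mul_smul_comm, smul_smul,
      ← mul_assoc, ← pow_succ, mul_assoc (a ^ x.1) (b ^ x.2) b, ← pow_succ]
    congr 2
    ring

end Coefficients

/-! ### Locally nilpotent operators and locally finite sums -/

/-- A power series with constant term `1` in a locally nilpotent operator is bijective. -/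
theorem bijective_of_locally_nilpotent {M : Type*} [AddCommGroup M] [Module k M]
    (Z U : Module.End k M) (f : ℕ → k) (hf : f 0 = 1) (hZ : ∀ t, ∃ N : ℕ, (Z ^ N) t = 0)
    (hU : ∀ (N : ℕ) (t : M), (Z ^ N) t = 0 → U t = ∑ n ∈ Finset.range N, f n • (Z ^ n) t) :
    Function.Bijective U := by
  -- The operator 1 - U is divisible by Z, so it lowers the order of nilpotency. If U t = 0, then t
  -- = t - U t descends to order zero; and a preimage s of t - U t gives the preimage s + t of t.
  have hsub (N : ℕ) (t : M) (ht : (Z ^ (N + 1)) t = 0) : (Z ^ N) (t - U t) = 0 := by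
    rw [hU _ t ht, Finset.sum_range_succ', hf, one_smul, pow_zero, Module.End.one_apply,
      sub_add_cancel_right, map_neg, map_sum, neg_eq_zero]
    refine Finset.sum_eq_zero fun n _ => ?_
    rw [map_smul, ← Module.End.mul_apply, ← pow_add, show N + (n + 1) = n + (N + 1) by omega,
      pow_add, Module.End.mul_apply, ht, map_zero, smul_zero]
  constructor
  · rw [injective_iff_map_eq_zero]
    intro t ht
    obtain ⟨N, hN⟩ := hZ t
    induction N with
    | zero => simpa using hN
    | succ N ih => exact ih (by simpa [ht] using hsub N t hN)
  · intro t
    obtain ⟨N, hN⟩ := hZ t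
    induction N generalizing t with
    | zero => exact ⟨0, by simpa using hN.symm⟩
    | succ N ih =>
      obtain ⟨s, hs⟩ := ih _ (hsub N t hN)
      exact ⟨s + t, by rw [map_add, hs, sub_add_cancel]⟩

theorem locallyFiniteSum_eq_sum {ι M N : Type*} [AddCommGroup M] [Module k M] [AddCommGroup N]
    [Module k N] (f : ι → M →ₗ[k] N) (hf) (x : M) (s : Finset ι)
    (hs : ∀ i ∉ s, f i x = 0) : locallyFiniteSum f hf x = ∑ i ∈ s, f i x :=
  finsum_eq_sum_of_support_subset _ fun i hi => by
    by_contra h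
    exact hi (hs i h)

/-- The sum over a square, cut into antidiagonals. -/
theorem sum_range_sum_antidiagonal {M : Type*} [AddCommMonoid M] (N : ℕ) (F : ℕ → ℕ → M)
    (h₁ : ∀ m p, N ≤ m → F m p = 0) (h₂ : ∀ m p, N ≤ p → F m p = 0) :
    ∑ n ∈ Finset.range (N + N), ∑ x ∈ Finset.HasAntidiagonal.antidiagonal n, F x.1 x.2 =
      ∑ p ∈ Finset.range N, ∑ m ∈ Finset.range N, F m p := by
  symm
  -- The square is fibred over m + p, which is less than 2N there; a point of an antidiagonal
  -- outside the square has a coordinate at least N and contributes zero.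
  rw [Finset.sum_comm, ← Finset.sum_product' _ _ F,
    ← Finset.sum_fiberwise_of_maps_to (t := Finset.range (N + N)) (g := fun x : ℕ × ℕ => x.1 + x.2)
      (by simp; omega)]
  refine Finset.sum_congr rfl fun n _ => Finset.sum_subset ?_ ?_
  · intro x
    simp
  · intro x hx hx'
    rw [Finset.HasAntidiagonal.mem_antidiagonal] at hx
    simp only [Finset.mem_filter, Finset.mem_product, Finset.mem_range, hx, and_true,
      not_and_or, not_lt] at hx'
    exact hx'.elim (h₁ _ _) (h₂ _ _)

/-! ### Weight spaces as eigenspaces of K -/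

namespace Sphere

variable (q : kˣ) (c : k)

/-- The operator by which `K` acts on the quantum sphere. -/
def opK : Module.End k (Sphere q c) := act q c (Uq.gen q .K)

/-- The subspace of weight `2 i`, as an eigenspace of `K = q ^ H`. -/
def weightSpace (i : ℤ) : Submodule k (Sphere q c) :=
  Module.End.eigenspace (opK q c) ((q : k) ^ (2 * i))

variable {q c}

theorem mem_weightSpace {i : ℤ} {a : Sphere q c} :
    a ∈ weightSpace q c i ↔ opK q c a = (q : k) ^ (2 * i) • a :=
  Module.End.mem_eigenspace_iff

theorem weightProj_mem (i : ℤ) (a : Sphere q c) : weightProj q c i a ∈ weightSpace q c i :=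
  mem_weightSpace.mpr (act_K_weightProj i a)

theorem opK_mul (a b : Sphere q c) : opK q c (a * b) = opK q c a * opK q c b := by
  simp [opK, act_apply, smulMap_mul, Uq.comul_gen, Uq.comulGen]

theorem opY_mul (a b : Sphere q c) :
    opY q c (a * b) = opY q c a * opK q c b + a * opY q c b := by
  simp [opY, opK, act_apply, smulMap_mul, Uq.comul_gen, Uq.comulGen, smulMap_one]

theorem opK_opX : opK q c * opX q c = (q : k) ^ 2 • (opX q c * opK q c) := by
  rw [opX, opK, ← map_mul, ← map_mul, Uq.K_X, map_smul]

theorem opK_opY : opK q c * opY q c = ((q : k) ^ 2)⁻¹ • (opY q c * opK q c) := by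
  rw [opY, opK, ← map_mul, ← map_mul, Uq.K_Y, map_smul]

theorem opY_opK : opY q c * opK q c = (q : k) ^ 2 • (opK q c * opY q c) := by
  rw [opK_opY, smul_smul, mul_inv_cancel₀ (pow_ne_zero 2 q.ne_zero), one_smul]

theorem opKinv_opK : opKinv q c * opK q c = 1 := by
  rw [opKinv, opK, ← map_mul, Uq.Kinv_K, map_one]

/-- K is group-like, so it acts multiplicatively and its eigenvalues multiply. -/
theorem mul_mem_weightSpace {i j : ℤ} {a b : Sphere q c} (ha : a ∈ weightSpace q c i)
    (hb : b ∈ weightSpace q c j) : a * b ∈ weightSpace q c (i + j) := by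
  rw [mem_weightSpace] at *
  rw [opK_mul, ha, hb, smul_mul_smul_comm, mul_add, zpow_add₀ q.ne_zero]

theorem opX_pow_mem {i : ℤ} {a : Sphere q c} (ha : a ∈ weightSpace q c i) (n : ℕ) :
    (opX q c ^ n) a ∈ weightSpace q c (i + n) := by
  induction n with
  | zero => simpa
  | succ n ih =>
    rw [mem_weightSpace] at *
    rw [pow_succ', Module.End.mul_apply, ← Module.End.mul_apply, opK_opX, LinearMap.smul_apply,
      Module.End.mul_apply, ih, map_smul, smul_smul, ← zpow_natCast, ← zpow_add₀ q.ne_zero]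
    congr 2
    push_cast
    ring

theorem opY_pow_mem {i : ℤ} {a : Sphere q c} (ha : a ∈ weightSpace q c i) (n : ℕ) :
    (opY q c ^ n) a ∈ weightSpace q c (i - n) := by
  induction n with
  | zero => simpa
  | succ n ih =>
    rw [mem_weightSpace] at *
    rw [pow_succ', Module.End.mul_apply, ← Module.End.mul_apply, opK_opY, LinearMap.smul_apply,
      Module.End.mul_apply, ih, map_smul, smul_smul, ← zpow_natCast, ← zpow_neg,
      ← zpow_add₀ q.ne_zero]
    congr 2
    push_cast
    ring

theorem opK_pow_apply {i : ℤ} {a : Sphere q c} (ha : a ∈ weightSpace q c i) (n : ℕ) :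
    (opK q c ^ n) a = (q : k) ^ (2 * i * n) • a := by
  rw [mem_weightSpace] at ha
  induction n with
  | zero => simp
  | succ n ih =>
    rw [pow_succ, Module.End.mul_apply, ha, map_smul, ih, smul_smul, ← zpow_add₀ q.ne_zero]
    congr 2
    push_cast
    ring

theorem opKinv_pow_apply {i : ℤ} {a : Sphere q c} (ha : a ∈ weightSpace q c i) (n : ℕ) :
    (opKinv q c ^ n) a = (q : k) ^ (-(2 * i * n)) • a := by
  rw [mem_weightSpace] at ha
  have h : opKinv q c a = (q : k) ^ (-(2 * i)) • a := by
    have h' : opKinv q c (opK q c a) = a := by rw [← Module.End.mul_apply, opKinv_opK]; rfl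
    rw [ha, map_smul] at h'
    conv_rhs => rw [← h']
    rw [smul_smul, ← zpow_add₀ q.ne_zero, neg_add_cancel, zpow_zero, one_smul]
  induction n with
  | zero => simp
  | succ n ih =>
    rw [pow_succ, Module.End.mul_apply, h, map_smul, ih, smul_smul, ← zpow_add₀ q.ne_zero]
    congr 2
    push_cast
    ring

-- Every element is a finite sum of its weight components, so additive statements need only be
-- checked on eigenvectors of K.
@[elab_as_elim]
theorem weight_induction {P : Sphere q c → Prop} (a : Sphere q c) (h_zero : P 0)
    (h_add : ∀ a b, P a → P b → P (a + b)) (h_wt : ∀ i, ∀ a ∈ weightSpace q c i, P a) : P a := by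
  rw [← finsum_weightProj a]
  exact finsum_induction _ h_zero (fun _ _ => h_add _ _) fun i => h_wt i _ (weightProj_mem i a)

/-- Linear maps on the tensor square agree if they agree on tensors of weight vectors. -/
theorem tensor_ext {M : Type*} [AddCommGroup M] [Module k M]
    {f g : Sphere q c ⊗[k] Sphere q c →ₗ[k] M}
    (h : ∀ i, ∀ a ∈ weightSpace q c i, ∀ j, ∀ b ∈ weightSpace q c j,
      f (a ⊗ₜ b) = g (a ⊗ₜ b)) : f = g := by
  refine TensorProduct.ext' fun a b => ?_
  induction a using weight_induction with
  | h_zero => simp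
  | h_add a a' ha ha' => simp [TensorProduct.add_tmul, ha, ha']
  | h_wt i a ha =>
    induction b using weight_induction with
    | h_zero => simp
    | h_add b b' hb hb' => simp [TensorProduct.tmul_add, hb, hb']
    | h_wt j b hb => exact h i a ha j b hb

/-- Linear maps on the tensor cube agree if they agree on tensors of weight vectors. -/
theorem tensor_ext₃ {M : Type*} [AddCommGroup M] [Module k M]
    {f g : Sphere q c ⊗[k] Sphere q c ⊗[k] Sphere q c →ₗ[k] M}
    (h : ∀ i, ∀ a ∈ weightSpace q c i, ∀ j, ∀ b ∈ weightSpace q c j,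
      ∀ l, ∀ d ∈ weightSpace q c l, f (a ⊗ₜ b ⊗ₜ d) = g (a ⊗ₜ b ⊗ₜ d)) : f = g := by
  refine TensorProduct.ext (tensor_ext fun i a ha j b hb => ?_)
  ext d
  induction d using weight_induction with
  | h_zero => simp
  | h_add d d' hd hd' =>
    simp only [TensorProduct.mk_apply, LinearMap.compr₂ₛₗ_apply] at hd hd' ⊢
    simp only [TensorProduct.tmul_add, map_add, hd, hd']
  | h_wt l d hd => exact h i a ha j b hb l d hd

/-! ### Weight projections and invertibility of the braiding -/

section Braiding

theorem zpow_two_mul_injective (hq : ∀ n : ℕ, 0 < n → q ^ n ≠ 1) :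
    Function.Injective fun i : ℤ => (q : k) ^ (2 * i) := by
  have h : ¬ IsOfFinOrder q := by
    rw [isOfFinOrder_iff_pow_eq_one]
    rintro ⟨n, hn, h⟩
    exact hq n hn h
  intro i j hij
  have := (injective_zpow_iff_not_isOfFinOrder.mpr h) (a₁ := 2 * i) (a₂ := 2 * j)
    (Units.ext (by simpa using hij))
  omega

variable (hq : ∀ n : ℕ, 0 < n → q ^ n ≠ 1)

include hq

/-- The projections come from the grading, the weight spaces from K. They match because distinct
indices give distinct eigenvalues of K, whose eigenspaces are independent. -/
theorem weightProj_eq_zero {i j : ℤ} (hij : j ≠ i) {a : Sphere q c}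
    (ha : a ∈ weightSpace q c i) : weightProj q c j a = 0 := by
  have ind : iSupIndep (weightSpace q c) :=
    (Module.End.eigenspaces_iSupIndep (opK q c)).comp (zpow_two_mul_injective hq)
  have hfin := finite_weightProj a
  have e := finsum_weightProj a
  rw [finsum_eq_sum_of_support_subset (s := insert j (insert i hfin.toFinset)) _
    (fun x hx => by simpa using .inr (.inr hx)),
    ← Finset.add_sum_erase _ _ (Finset.mem_insert_self j _)] at e
  refine Submodule.disjoint_def.mp (ind j) _ (weightProj_mem j a) ?_
  -- The component at j is a minus its other components, hence lies in the span of the other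
  -- eigenspaces as well as in its own.
  rw [eq_sub_of_add_eq e]
  refine sub_mem (Submodule.mem_iSup_of_mem i (Submodule.mem_iSup_of_mem hij.symm ha)) ?_
  refine sum_mem fun l hl => ?_
  exact Submodule.mem_iSup_of_mem l (Submodule.mem_iSup_of_mem (Finset.ne_of_mem_erase hl)
    (weightProj_mem l a))

theorem weightProj_eq_self {i : ℤ} {a : Sphere q c}
    (ha : a ∈ weightSpace q c i) : weightProj q c i a = a := by
  conv_rhs => rw [← finsum_weightProj a]
  exact (finsum_eq_single _ i fun j hj => weightProj_eq_zero hq hj ha).symm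

/-- The scalars f are arbitrary so that this serves both the Cartan part and its inverse. -/
theorem locallyFiniteSum_weightProj (f : ℤ × ℤ → k) (hf) {i j : ℤ} {a b : Sphere q c}
    (ha : a ∈ weightSpace q c i) (hb : b ∈ weightSpace q c j) :
    locallyFiniteSum (fun p : ℤ × ℤ => f p •
      TensorProduct.map (weightProj q c p.1) (weightProj q c p.2)) hf (a ⊗ₜ b) =
        f (i, j) • a ⊗ₜ b := by
  rw [locallyFiniteSum_eq_sum _ _ _ {(i, j)}]
  · simp [weightProj_eq_self hq ha, weightProj_eq_self hq hb]
  · rintro ⟨i', j'⟩ h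
    by_cases hi : i' = i
    · have hj : j' ≠ j := fun hj => h (by simp [hi, hj])
      simp [weightProj_eq_zero hq hj hb]
    · simp [weightProj_eq_zero hq hi ha]

theorem cartanPart_tmul {i j : ℤ} {a b : Sphere q c}
    (ha : a ∈ weightSpace q c i) (hb : b ∈ weightSpace q c j) :
    cartanPart q c (a ⊗ₜ b) = (q : k) ^ (2 * i * j) • a ⊗ₜ b :=
  locallyFiniteSum_weightProj hq _ _ ha hb

omit hq in
theorem finite_weightProj_tensor (t : Sphere q c ⊗[k] Sphere q c) (f : ℤ × ℤ → k) :
    {p : ℤ × ℤ | (f p •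
      TensorProduct.map (weightProj q c p.1) (weightProj q c p.2)) t ≠ 0}.Finite := by
  induction t with
  | zero => simp
  | add s t hs ht =>
    refine (hs.union ht).subset fun p hp => ?_
    by_contra h
    simp only [Set.mem_union, Set.mem_ofPred_eq, not_or, not_not] at h
    exact hp (by rw [map_add, h.1, h.2, add_zero])
  | tmul a b =>
    refine ((finite_weightProj a).prod (finite_weightProj b)).subset fun p hp => ?_
    refine ⟨fun h => hp ?_, fun h => hp ?_⟩ <;> simp [h]

/-- The inverse is the diagonal operator with opposite exponents. -/
theorem bijective_cartanPart : Function.Bijective (cartanPart q c) := by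
  let C : Module.End k (Sphere q c ⊗[k] Sphere q c) := locallyFiniteSum
    (fun p : ℤ × ℤ => (q : k) ^ (-(2 * p.1 * p.2)) •
      TensorProduct.map (weightProj q c p.1) (weightProj q c p.2))
    (fun t => finite_weightProj_tensor t _)
  have hC {i j : ℤ} {a b : Sphere q c} (ha : a ∈ weightSpace q c i)
      (hb : b ∈ weightSpace q c j) : C (a ⊗ₜ b) = (q : k) ^ (-(2 * i * j)) • a ⊗ₜ b :=
    locallyFiniteSum_weightProj hq (fun p => (q : k) ^ (-(2 * p.1 * p.2))) _ ha hb
  have h₁ : C ∘ₗ cartanPart q c = LinearMap.id := tensor_ext fun i a ha j b hb => by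
    rw [LinearMap.comp_apply, cartanPart_tmul hq ha hb, map_smul, hC ha hb, smul_smul,
      ← zpow_add₀ q.ne_zero, add_neg_cancel, zpow_zero, one_smul, LinearMap.id_apply]
  have h₂ : cartanPart q c ∘ₗ C = LinearMap.id := tensor_ext fun i a ha j b hb => by
    rw [LinearMap.comp_apply, hC ha hb, map_smul, cartanPart_tmul hq ha hb, smul_smul,
      ← zpow_add₀ q.ne_zero, neg_add_cancel, zpow_zero, one_smul, LinearMap.id_apply]
  exact Function.bijective_iff_has_inverse.mpr
    ⟨C, LinearMap.congr_fun h₁, LinearMap.congr_fun h₂⟩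

omit hq in
theorem bijective_unipotentPart : Function.Bijective (unipotentPart q c) := by
  refine bijective_of_locally_nilpotent (TensorProduct.map (opX q c) (opY q c)) _ (coeffR q)
    (by simp [coeffR, qFactorial]) (fun t => ?_) (fun N t ht => ?_)
  · induction t with
    | zero => exact ⟨0, by simp⟩
    | add s t hs ht =>
      obtain ⟨m, hm⟩ := hs
      obtain ⟨n, hn⟩ := ht
      refine ⟨m + n, ?_⟩
      rw [map_add, pow_add, Module.End.mul_apply, Module.End.mul_apply, hn, map_zero, add_zero,
        ← Module.End.mul_apply, ← pow_add, add_comm, pow_add, Module.End.mul_apply, hm, map_zero]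
    | tmul a b =>
      obtain ⟨N, hN⟩ := exists_opX_pow_eq_zero a
      exact ⟨N, by rw [TensorProduct.map_pow, TensorProduct.map_tmul, hN,
        TensorProduct.zero_tmul]⟩
  · rw [unipotentPart, locallyFiniteSum_eq_sum _ _ _ (Finset.range N)]
    · simp [TensorProduct.map_pow]
    · intro n hn
      obtain ⟨m, rfl⟩ := Nat.exists_eq_add_of_le' (not_lt.mp (Finset.mem_range.not.mp hn))
      rw [LinearMap.smul_apply, ← TensorProduct.map_pow, pow_add, Module.End.mul_apply, ht,
        map_zero, smul_zero]

theorem bijective_braiding : Function.Bijective (braiding q c) :=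
  (TensorProduct.comm k _ _).bijective.comp
    (bijective_unipotentPart.comp (bijective_cartanPart hq))

/-- Any N with Xᴺa = 0 is allowed, so that sums coming from different vectors can share one range.
-/
theorem braiding_tmul {i j : ℤ} {a b : Sphere q c} (ha : a ∈ weightSpace q c i)
    (hb : b ∈ weightSpace q c j) {N : ℕ} (hN : (opX q c ^ N) a = 0) :
    braiding q c (a ⊗ₜ b) = (q : k) ^ (2 * i * j) •
      ∑ n ∈ Finset.range N, coeffR q n • ((opY q c ^ n) b ⊗ₜ (opX q c ^ n) a) := by
  rw [braiding, actR, LinearMap.comp_apply, Module.End.mul_apply, cartanPart_tmul hq ha hb,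
    unipotentPart, map_smul, locallyFiniteSum_eq_sum _ _ _ (Finset.range N)]
  · simp
  · intro n hn
    simp [opX_pow_add (not_lt.mp (Finset.mem_range.not.mp hn)) a hN]

/-! ### Coproducts of divided powers and compatibility with the product -/

/-- The coproduct of the divided powers of `X`. -/
theorem coeffR_smul_opX_pow_mul {i : ℤ} {a : Sphere q c} (ha : a ∈ weightSpace q c i)
    (b : Sphere q c) (n : ℕ) :
    coeffR q n • (opX q c ^ n) (a * b) = ∑ x ∈ Finset.HasAntidiagonal.antidiagonal n,
      (coeffR q x.1 * coeffR q x.2 * (q : k) ^ (-(2 * i * x.2))) •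
        ((opX q c ^ x.1) a * (opX q c ^ x.2) b) := by
  -- Δ(X) acts as A + B, and XK⁻¹ = q²K⁻¹X gives AB = q²BA. In AᵐBᵖ the factor K⁻ᵖ acts on a by a
  -- scalar.
  let A := TensorProduct.map (opX q c) (1 : Module.End k (Sphere q c))
  let B := TensorProduct.map (opKinv q c) (opX q c)
  have hAB : A * B = (q : k) ^ 2 • (B * A) := by
    simp only [A, B, ← TensorProduct.map_mul, one_mul, mul_one, opX_opKinv,
      TensorProduct.map_smul_left]
  have hμ (t) : opX q c (LinearMap.mul' k _ t) = LinearMap.mul' k _ ((A + B) t) := by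
    induction t with
    | zero => simp
    | add s t hs ht => rw [map_add, map_add, hs, ht, map_add, map_add]
    | tmul a b => simp [A, B, opX_mul]
  have hμn (n : ℕ) (t) : (opX q c ^ n) (LinearMap.mul' k _ t) =
      LinearMap.mul' k _ (((A + B) ^ n) t) := by
    induction n generalizing t with
    | zero => simp
    | succ n ih => rw [pow_succ, Module.End.mul_apply, hμ, ih, pow_succ, Module.End.mul_apply]
  rw [← LinearMap.mul'_apply (R := k), hμn, ← map_smul, ← LinearMap.smul_apply,
    coeffR_smul_add_pow hq hAB, LinearMap.sum_apply, map_sum]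
  refine Finset.sum_congr rfl fun x _ => ?_
  simp [A, B, TensorProduct.map_pow, opKinv_pow_apply ha, smul_smul]

/-- The coproduct of the divided powers of `Y`. -/
theorem coeffR_smul_opY_pow_mul {j : ℤ} (a : Sphere q c) {b : Sphere q c}
    (hb : b ∈ weightSpace q c j) (n : ℕ) :
    coeffR q n • (opY q c ^ n) (a * b) = ∑ x ∈ Finset.HasAntidiagonal.antidiagonal n,
      (coeffR q x.1 * coeffR q x.2 * (q : k) ^ (2 * j * x.2)) •
        ((opY q c ^ x.2) a * (opY q c ^ x.1) b) := by
  -- The summand 1 ⊗ Y comes first: YK = q²KY makes this the order in which AB = q²BA. Hence the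
  -- first index of the antidiagonal goes to the second factor.
  let A := TensorProduct.map (1 : Module.End k (Sphere q c)) (opY q c)
  let B := TensorProduct.map (opY q c) (opK q c)
  have hAB : A * B = (q : k) ^ 2 • (B * A) := by
    simp only [A, B, ← TensorProduct.map_mul, one_mul, mul_one, opY_opK,
      TensorProduct.map_smul_right]
  have hμ (t) : opY q c (LinearMap.mul' k _ t) = LinearMap.mul' k _ ((A + B) t) := by
    induction t with
    | zero => simp
    | add s t hs ht => rw [map_add, map_add, hs, ht, map_add, map_add]
    | tmul a b => simp [A, B, opY_mul, add_comm]
  have hμn (n : ℕ) (t) : (opY q c ^ n) (LinearMap.mul' k _ t) =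
      LinearMap.mul' k _ (((A + B) ^ n) t) := by
    induction n generalizing t with
    | zero => simp
    | succ n ih => rw [pow_succ, Module.End.mul_apply, hμ, ih, pow_succ, Module.End.mul_apply]
  rw [← LinearMap.mul'_apply (R := k), hμn, ← map_smul, ← LinearMap.smul_apply,
    coeffR_smul_add_pow hq hAB, LinearMap.sum_apply, map_sum]
  refine Finset.sum_congr rfl fun x _ => ?_
  simp [A, B, TensorProduct.map_pow, opK_pow_apply hb, smul_smul]

theorem braiding_mul12 : braiding q c ∘ₗ mul12 k (Sphere q c) =
    mul23 k (Sphere q c) ∘ₗ op12 (braiding q c) ∘ₗ op23 (braiding q c) := by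
  refine tensor_ext₃ fun i a ha j b hb l d hd => ?_
  obtain ⟨Na, hNa⟩ := exists_opX_pow_eq_zero a
  obtain ⟨Nb, hNb⟩ := exists_opX_pow_eq_zero b
  -- A common bound for a and b makes the double sum run over a square.
  obtain ⟨N, hN, hN'⟩ : ∃ N, (opX q c ^ N) a = 0 ∧ (opX q c ^ N) b = 0 :=
    ⟨Na + Nb, opX_pow_add (by omega) a hNa, opX_pow_add (by omega) b hNb⟩
  have hab : (opX q c ^ (N + N)) (a * b) = 0 := opX_pow_mul _ N N a b rfl hN hN'
  have lhs : (braiding q c ∘ₗ mul12 k (Sphere q c)) (a ⊗ₜ b ⊗ₜ d) =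
      (q : k) ^ (2 * (i + j) * l) • ∑ n ∈ Finset.range (N + N), ∑ x ∈ Finset.HasAntidiagonal.antidiagonal n,
        (coeffR q x.1 * coeffR q x.2 * (q : k) ^ (-(2 * i * x.2))) •
          ((opY q c ^ (x.1 + x.2)) d ⊗ₜ[k] ((opX q c ^ x.1) a * (opX q c ^ x.2) b)) := by
    rw [LinearMap.comp_apply, mul12, LinearMap.rTensor_tmul, LinearMap.mul'_apply,
      braiding_tmul hq (mul_mem_weightSpace ha hb) hd hab]
    congr 1
    refine Finset.sum_congr rfl fun n _ => ?_
    rw [← TensorProduct.tmul_smul, coeffR_smul_opX_pow_mul hq ha, TensorProduct.tmul_sum]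
    refine Finset.sum_congr rfl fun x hx => ?_
    rw [TensorProduct.tmul_smul, Finset.HasAntidiagonal.mem_antidiagonal.mp hx]
  rw [lhs, sum_range_sum_antidiagonal N (fun m p =>
        (coeffR q m * coeffR q p * (q : k) ^ (-(2 * i * p))) •
          ((opY q c ^ (m + p)) d ⊗ₜ[k] ((opX q c ^ m) a * (opX q c ^ p) b)))
    (fun m p h => by simp [opX_pow_add h a hN]) (fun m p h => by simp [opX_pow_add h b hN'])]
  have e23 : op23 (braiding q c) (a ⊗ₜ b ⊗ₜ d) = (q : k) ^ (2 * j * l) •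
      ∑ p ∈ Finset.range N, coeffR q p • (a ⊗ₜ (opY q c ^ p) d ⊗ₜ (opX q c ^ p) b) := by
    simp [op23, braiding_tmul hq hb hd hN', TensorProduct.tmul_sum]
  -- The index of Yᵖd is l - p; the resulting factor with exponent -2ip is the one that K⁻ᵖ produces
  -- on a in the coproduct of Xⁿ.
  have e12 (p : ℕ) : op12 (braiding q c) (a ⊗ₜ (opY q c ^ p) d ⊗ₜ (opX q c ^ p) b) =
      (q : k) ^ (2 * i * (l - p)) • ∑ m ∈ Finset.range N, coeffR q m •
        ((opY q c ^ (m + p)) d ⊗ₜ (opX q c ^ m) a ⊗ₜ (opX q c ^ p) b) := by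
    simp only [op12, LinearMap.rTensor_tmul, braiding_tmul hq ha (opY_pow_mem hd p) hN,
      TensorProduct.sum_tmul, ← TensorProduct.smul_tmul', pow_add, Module.End.mul_apply]
  rw [LinearMap.comp_apply, LinearMap.comp_apply, e23]
  simp only [map_smul, map_sum, e12, Finset.smul_sum]
  refine Finset.sum_congr rfl fun p _ => Finset.sum_congr rfl fun m _ => ?_
  simp only [mul23, LinearMap.comp_apply, LinearEquiv.coe_coe, TensorProduct.assoc_tmul,
    LinearMap.lTensor_tmul, LinearMap.mul'_apply, smul_smul]
  congr 1
  have e : (q : k) ^ (2 * (i + j) * l) * (q : k) ^ (-(2 * i * p)) =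
      (q : k) ^ (2 * j * l) * (q : k) ^ (2 * i * (l - p)) := by
    rw [← zpow_add₀ q.ne_zero, ← zpow_add₀ q.ne_zero]
    congr 1
    ring
  linear_combination coeffR q m * coeffR q p * e

theorem braiding_mul23 : braiding q c ∘ₗ mul23 k (Sphere q c) =
    mul12 k (Sphere q c) ∘ₗ op23 (braiding q c) ∘ₗ op12 (braiding q c) := by
  refine tensor_ext₃ fun i a ha j b hb l d hd => ?_
  obtain ⟨N, hN⟩ := exists_opX_pow_eq_zero a
  -- Xᴺ already kills a; the longer range N + N lets the antidiagonals cover the square of side N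
  -- that appears on the other side.
  have lhs : (braiding q c ∘ₗ mul23 k (Sphere q c)) (a ⊗ₜ b ⊗ₜ d) =
      (q : k) ^ (2 * i * (j + l)) • ∑ n ∈ Finset.range (N + N), ∑ x ∈ Finset.HasAntidiagonal.antidiagonal n,
        (coeffR q x.1 * coeffR q x.2 * (q : k) ^ (2 * l * x.2)) •
          (((opY q c ^ x.2) b * (opY q c ^ x.1) d) ⊗ₜ[k] (opX q c ^ (x.1 + x.2)) a) := by
    rw [LinearMap.comp_apply, mul23, LinearMap.comp_apply, LinearEquiv.coe_coe,
      TensorProduct.assoc_tmul, LinearMap.lTensor_tmul, LinearMap.mul'_apply,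
      braiding_tmul hq ha (mul_mem_weightSpace hb hd)
        (opX_pow_add (Nat.le_add_left N N) a hN)]
    congr 1
    refine Finset.sum_congr rfl fun n _ => ?_
    rw [TensorProduct.smul_tmul', coeffR_smul_opY_pow_mul hq _ hd, TensorProduct.sum_tmul]
    refine Finset.sum_congr rfl fun x hx => ?_
    rw [← TensorProduct.smul_tmul', Finset.HasAntidiagonal.mem_antidiagonal.mp hx]
  rw [lhs, sum_range_sum_antidiagonal N (fun m p =>
        (coeffR q m * coeffR q p * (q : k) ^ (2 * l * p)) •
          (((opY q c ^ p) b * (opY q c ^ m) d) ⊗ₜ[k] (opX q c ^ (m + p)) a))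
    (fun m p h => by simp [opX_pow_add (show N ≤ m + p by omega) a hN])
    (fun m p h => by simp [opX_pow_add (show N ≤ m + p by omega) a hN])]
  have e12 : op12 (braiding q c) (a ⊗ₜ b ⊗ₜ d) = (q : k) ^ (2 * i * j) •
      ∑ p ∈ Finset.range N, coeffR q p • ((opY q c ^ p) b ⊗ₜ (opX q c ^ p) a ⊗ₜ d) := by
    simp only [op12, LinearMap.rTensor_tmul, braiding_tmul hq ha hb hN,
      TensorProduct.sum_tmul, ← TensorProduct.smul_tmul']
  -- The index of Xᵖa is i + p; the extra exponent 2pl is the one that Kᵖ produces on d in the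
  -- coproduct of Yⁿ.
  have e23 (p : ℕ) : op23 (braiding q c) ((opY q c ^ p) b ⊗ₜ (opX q c ^ p) a ⊗ₜ d) =
      (q : k) ^ (2 * (i + p) * l) • ∑ m ∈ Finset.range N, coeffR q m •
        ((opY q c ^ p) b ⊗ₜ (opY q c ^ m) d ⊗ₜ (opX q c ^ (m + p)) a) := by
    have h : (opX q c ^ N) ((opX q c ^ p) a) = 0 := by
      rw [← Module.End.mul_apply, ← pow_add]
      exact opX_pow_add (Nat.le_add_right N p) a hN
    simp [op23, braiding_tmul hq (opX_pow_mem ha p) hd h, TensorProduct.tmul_sum, pow_add]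
  rw [LinearMap.comp_apply, LinearMap.comp_apply, e12]
  simp only [map_smul, map_sum, e23, Finset.smul_sum]
  refine Finset.sum_congr rfl fun p _ => Finset.sum_congr rfl fun m _ => ?_
  simp only [mul12, LinearMap.rTensor_tmul, LinearMap.mul'_apply, smul_smul]
  congr 1
  have e : (q : k) ^ (2 * i * (j + l)) * (q : k) ^ (2 * l * p) =
      (q : k) ^ (2 * i * j) * (q : k) ^ (2 * (i + p) * l) := by
    rw [← zpow_add₀ q.ne_zero, ← zpow_add₀ q.ne_zero]
    congr 1
    ring
  linear_combination coeffR q m * coeffR q p * e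

end Braiding

end Sphere

/-! ### Passing to the inverse braiding -/

section Legs

variable {A : Type*} [Ring A] [Algebra k A]

theorem op12_comp (S T : Module.End k (A ⊗[k] A)) : op12 S ∘ₗ op12 T = op12 (S ∘ₗ T) :=
  (LinearMap.rTensor_comp A S T).symm

theorem op23_comp (S T : Module.End k (A ⊗[k] A)) : op23 S ∘ₗ op23 T = op23 (S ∘ₗ T) := by
  ext
  simp [op23]

theorem op12_id : op12 (LinearMap.id : Module.End k (A ⊗[k] A)) = LinearMap.id :=
  LinearMap.rTensor_id _ _

theorem op23_id : op23 (LinearMap.id : Module.End k (A ⊗[k] A)) = LinearMap.id := by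
  ext
  simp [op23]

/-- The compatibility of the inverse of a braiding with the product in the last two factors. -/
theorem symm_comp_mul23 (S : A ⊗[k] A ≃ₗ[k] A ⊗[k] A)
    (h : S.toLinearMap ∘ₗ mul12 k A =
      mul23 k A ∘ₗ op12 S.toLinearMap ∘ₗ op23 S.toLinearMap) :
    S.symm.toLinearMap ∘ₗ mul23 k A =
      mul12 k A ∘ₗ op23 S.symm.toLinearMap ∘ₗ op12 S.symm.toLinearMap := by
  -- The hypothesis is composed on the right with the inverses of its two legs in reverse order;
  -- cancelling `S` on the left then finishes.
  have e : mul23 k A = S.toLinearMap ∘ₗ mul12 k A ∘ₗ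
      op23 S.symm.toLinearMap ∘ₗ op12 S.symm.toLinearMap := by
    rw [← LinearMap.comp_assoc, h, LinearMap.comp_assoc, LinearMap.comp_assoc,
      ← LinearMap.comp_assoc (op12 _) (op23 _) (op23 _), op23_comp, LinearEquiv.comp_symm,
      op23_id, LinearMap.id_comp, op12_comp, LinearEquiv.comp_symm, op12_id, LinearMap.comp_id]
  conv_lhs => rw [e, ← LinearMap.comp_assoc, LinearEquiv.symm_comp, LinearMap.id_comp]

/-- The compatibility of the inverse of a braiding with the product in the first two factors. -/
theorem symm_comp_mul12 (S : A ⊗[k] A ≃ₗ[k] A ⊗[k] A)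
    (h : S.toLinearMap ∘ₗ mul23 k A =
      mul12 k A ∘ₗ op23 S.toLinearMap ∘ₗ op12 S.toLinearMap) :
    S.symm.toLinearMap ∘ₗ mul12 k A =
      mul23 k A ∘ₗ op12 S.symm.toLinearMap ∘ₗ op23 S.symm.toLinearMap := by
  have e : mul12 k A = S.toLinearMap ∘ₗ mul23 k A ∘ₗ
      op12 S.symm.toLinearMap ∘ₗ op23 S.symm.toLinearMap := by
    rw [← LinearMap.comp_assoc, h, LinearMap.comp_assoc, LinearMap.comp_assoc,
      ← LinearMap.comp_assoc (op23 _) (op12 _) (op12 _), op12_comp, LinearEquiv.comp_symm,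
      op12_id, LinearMap.id_comp, op23_comp, LinearEquiv.comp_symm, op23_id, LinearMap.comp_id]
  conv_lhs => rw [e, ← LinearMap.comp_assoc, LinearEquiv.symm_comp, LinearMap.id_comp]

end Legs

end QSphere

end

/-- The braiding `S = σ R` of the quantum sphere, for `q` not a root of unity, is invertible, and both
`T = S` and `T = S⁻¹` satisfy `T μ¹² = μ²³ T¹² T²³` and `T μ²³ = μ¹² T²³ T¹²`. -/
theorem proposition1 {k : Type*} [RCLike k] (q : kˣ) (hq : ∀ n : ℕ, 0 < n → q ^ n ≠ 1)
    (c : k) (hc : c ≠ 0) :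
    ∃ S : QSphere.Sphere q c ⊗[k] QSphere.Sphere q c ≃ₗ[k]
        QSphere.Sphere q c ⊗[k] QSphere.Sphere q c,
      S.toLinearMap = QSphere.Sphere.braiding q c ∧
      ∀ T ∈ ({S.toLinearMap, S.symm.toLinearMap} :
          Set (Module.End k (QSphere.Sphere q c ⊗[k] QSphere.Sphere q c))),
        T ∘ₗ QSphere.mul12 k (QSphere.Sphere q c) =
          QSphere.mul23 k (QSphere.Sphere q c) ∘ₗ QSphere.op12 T ∘ₗ QSphere.op23 T ∧
        T ∘ₗ QSphere.mul23 k (QSphere.Sphere q c) =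
          QSphere.mul12 k (QSphere.Sphere q c) ∘ₗ QSphere.op23 T ∘ₗ QSphere.op12 T := by
  let S := LinearEquiv.ofBijective (QSphere.Sphere.braiding q c)
    (QSphere.Sphere.bijective_braiding hq)
  have hS : S.toLinearMap = QSphere.Sphere.braiding q c := rfl
  have h₁₂ := QSphere.Sphere.braiding_mul12 (c := c) hq
  have h₂₃ := QSphere.Sphere.braiding_mul23 (c := c) hq
  rw [← hS] at h₁₂ h₂₃
  refine ⟨S, hS, ?_⟩
  rintro T (rfl | rfl)
  · exact ⟨h₁₂, h₂₃⟩
  -- Inversion exchanges the two identities.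
  · exact ⟨QSphere.symm_comp_mul12 S h₂₃, QSphere.symm_comp_mul23 S h₁₂⟩
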